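/- \textbf{Proposition.} All trees are rooted, unordered and locally finite, i.e. they are equivalence classes of plane trees (in which each vertex has finitely many children) under root- and parent-preserving bijections. For a tree $t$ and an integer $R\ge 0$, let $t|_R$ be the ball of radius $R$ around the root for the graph distance; the set of trees is endowed with the local distance $d_{\mathrm{loc}}(t,s)=\exp(-\inf\{R\ge 0 : t|_R\neq s|_R\})$. Write $c_u(t)$ for the number of children of a vertex $u$ of $t$; a leaf is a vertex without children. \emph{Growing trees.} Let $0<\gamma\le\alpha\le 1$. Let $T_1$ be the tree with one vertex and $T_2$ the tree with two leaves attached to its root. For $n\ge 3$, conditionally on $T_{n-1}$, regarded as a planted tree (a phantom edge is attached under the root), give each edge the weight $1-\alpha$ if it ends with a leaf and $\gamma$ otherwise, and each non-leaf vertex $u$ the weight $(c_u(T_{n-1})-1)\alpha-\gamma$; pick an edge or a vertex with probability proportional to these weights; if an edge was picked, place a new vertex at its middle and attach a new leaf to it; if a vertex was picked, attach a new leaf to it. The tree obtained is $T_n$, and $\mathrm{AG}^n_{\alpha,\gamma}$ denotes its law; $T_n$ has $n$ leaves. \emph{Beta geometric laws.} For $0<\theta<1$, a random variable $X$ is beta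 geometric with parameters $(\theta,1-\theta)$ if there is a Beta variable $\Pi$ with parameters $(1-\theta,\theta)$ such that $\mathbb P(X=n\mid\Pi)=\Pi^n(1-\Pi)$ for all integers $n\ge 0$. For $\theta=1$ the convention is $X=0$ almost surely. \emph{Infinite tree.} Let $(X_n)_{n\ge 0}$ be i.i.d. beta geometric variables with parameters $(\gamma/\alpha,1-\gamma/\alpha)$. Independently, let $(Y_{n,k},\tau_{n,k})_{n,k\ge 0}$ be i.i.d. pairs such that $Y_{n,k}$ is beta geometric with parameters $(\alpha,1-\alpha)$ and, conditionally on $Y_{n,k}=\ell$, $\tau_{n,k}$ has law $\mathrm{AG}^{\ell+1}_{\alpha,\gamma}$. Let $T_\infty$ be the tree obtained from an infinite branch with vertices $v_0$ (the root), $v_1,v_2,\dots$ by attaching to $v_n$, for every $n\ge 0$, the $X_n+1$ trees $\tau_{n,0},\dots,\tau_{n,X_n}$, each by an edge from $v_n$ to its root. Let $\mathrm{AG}^\infty_{\alpha,\gamma}$ be the law of $T_\infty$. Then, for all $0<\gamma\le\alpha\le 1$, the probability measures $\mathrm{AG}^n_{\alpha,\gamma}$ converge weakly to $\mathrm{AG}^\infty_{\alpha,\gamma}$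 as $n\to\infty$, with respect to the topology induced by $d_{\mathrm{loc}}$. -/

import Mathlib

open MeasureTheory ProbabilityTheory Filter Topology
open scoped ENNReal

namespace AlphaGamma

/-! ### Plane trees and unordered trees -/

/-- A plane tree (ordered rooted tree) in Neveu's formalism: a set of finite words over `ℕ` that
contains the empty word (the root), is closed under taking parents, and in which every vertex `u`
has finitely many children, namely the words `u ++ [i]` with `i < c` for some `c : ℕ`.
The letters start at `0`, so that the children of `u` are `u 0, …, u (c - 1)`. -/
@[ext]
structure PlaneTree where
  carrier : Set (List ℕ)
  root_mem : [] ∈ carrier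
  parent_mem : ∀ (u : List ℕ) (i : ℕ), u ++ [i] ∈ carrier → u ∈ carrier
  children : ∀ u ∈ carrier, ∃ c : ℕ, ∀ i : ℕ, u ++ [i] ∈ carrier ↔ i < c

namespace PlaneTree

/-- The number of children `c_u(t)` of the vertex `u` in `t`. -/
noncomputable def numChildren (t : PlaneTree) (u : List ℕ) : ℕ :=
  Set.ncard {i : ℕ | u ++ [i] ∈ t.carrier}

theorem mem_iff_lt_numChildren (t : PlaneTree) {u : List ℕ} (hu : u ∈ t.carrier) (i : ℕ) :
    u ++ [i] ∈ t.carrier ↔ i < t.numChildren u := by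
  obtain ⟨c, hc⟩ := t.children u hu
  have h : t.numChildren u = c := by
    have : {i : ℕ | u ++ [i] ∈ t.carrier} = (Finset.range c : Set ℕ) := by
      ext i; simp [hc]
    rw [numChildren, this, Set.ncard_coe_finset, Finset.card_range]
  rw [h, hc]

theorem dropLast_mem (t : PlaneTree) {u : List ℕ} (hu : u ∈ t.carrier) :
    u.dropLast ∈ t.carrier := by
  rcases List.eq_nil_or_concat u with rfl | ⟨v, i, rfl⟩
  · simpa using hu
  · simpa using t.parent_mem v i (by simpa using hu)

theorem mem_of_append (t : PlaneTree) (u w : List ℕ) (h : u ++ w ∈ t.carrier) : u ∈ t.carrier := by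
  induction w using List.reverseRecOn with
  | nil => simpa using h
  | append_singleton w i ih =>
    rw [← List.append_assoc] at h
    exact ih (t.parent_mem _ _ h)

/-- The root of `t`, as a vertex. -/
def root (t : PlaneTree) : t.carrier := ⟨[], t.root_mem⟩

/-- The parent of a vertex `u`; by convention the parent of the root is the root. -/
def parent (t : PlaneTree) (u : t.carrier) : t.carrier := ⟨u.1.dropLast, t.dropLast_mem u.2⟩

/-- Two plane trees have the same shape if there is a bijection between their vertices that
preserves the root and the parent of each vertex different from the root. -/
def Equivalent (t s : PlaneTree) : Prop :=
  ∃ σ : t.carrier ≃ s.carrier, σ t.root = s.root ∧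
    ∀ u : t.carrier, u ≠ t.root → s.parent (σ u) = σ (t.parent u)

theorem parent_root (t : PlaneTree) : t.parent t.root = t.root := rfl

theorem Equivalent.refl (t : PlaneTree) : Equivalent t t := ⟨Equiv.refl _, rfl, fun _ _ => rfl⟩

theorem Equivalent.symm {t s : PlaneTree} : Equivalent t s → Equivalent s t := by
  rintro ⟨σ, h0, h1⟩
  refine ⟨σ.symm, by rw [← h0, Equiv.symm_apply_apply], fun u hu => ?_⟩
  have : σ.symm u ≠ t.root := by
    intro h; apply hu; rw [← h0, ← h, Equiv.apply_symm_apply]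
  have := h1 _ this
  rw [Equiv.apply_symm_apply] at this
  rw [this, Equiv.symm_apply_apply]

theorem Equivalent.trans {t s r : PlaneTree} :
    Equivalent t s → Equivalent s r → Equivalent t r := by
  rintro ⟨σ, h0, h1⟩ ⟨τ, k0, k1⟩
  refine ⟨σ.trans τ, by simp [h0, k0], fun u hu => ?_⟩
  have : σ u ≠ s.root := by
    rw [← h0]; exact fun h => hu (σ.injective h)
  simp only [Equiv.trans_apply]
  rw [k1 _ this, h1 _ hu]

instance setoid : Setoid PlaneTree :=
  ⟨Equivalent, Equivalent.refl, Equivalent.symm, Equivalent.trans⟩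

/-- The closed ball of radius `R` around the root: the vertices at graph distance at most `R`
from the root, i.e. the words of length at most `R`. -/
def ball (R : ℕ) (t : PlaneTree) : PlaneTree where
  carrier := {u | u ∈ t.carrier ∧ u.length ≤ R}
  root_mem := ⟨t.root_mem, by simp⟩
  parent_mem u i h := ⟨t.parent_mem u i h.1, by have := h.2; simp at this; omega⟩
  children u hu := by
    obtain ⟨c, hc⟩ := t.children u hu.1
    by_cases h : u.length < R
    · exact ⟨c, fun i => by simp [hc]; omega⟩
    · exact ⟨0, fun i => by simp; omega⟩

theorem length_eq {t s : PlaneTree} (σ : t.carrier ≃ s.carrier) (h0 : σ t.root = s.root)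
    (h1 : ∀ u : t.carrier, u ≠ t.root → s.parent (σ u) = σ (t.parent u)) (n : ℕ) :
    ∀ u : t.carrier, u.1.length = n → (σ u).1.length = n := by
  induction n with
  | zero =>
    intro u hu
    have : u = t.root := Subtype.ext (List.length_eq_zero_iff.1 hu)
    rw [this, h0]; rfl
  | succ n ih =>
    intro u hu
    have hne : u ≠ t.root := by rintro rfl; simp [root] at hu
    have hp := ih (t.parent u) (by simp [parent, hu])
    rw [← h1 u hne] at hp
    have hne' : σ u ≠ s.root := by rw [← h0]; exact fun h => hne (σ.injective h)
    have : (σ u).1.length ≠ 0 := fun h => hne' (Subtype.ext (List.length_eq_zero_iff.1 h))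
    simp [parent] at hp
    omega

theorem Equivalent.ball {t s : PlaneTree} (R : ℕ) (h : Equivalent t s) :
    Equivalent (ball R t) (ball R s) := by
  obtain ⟨σ, h0, h1⟩ := h
  have hl : ∀ u : t.carrier, (σ u).1.length = u.1.length := fun u => length_eq σ h0 h1 _ u rfl
  refine ⟨⟨fun u => ⟨(σ ⟨u.1, u.2.1⟩).1, (σ ⟨u.1, u.2.1⟩).2, ?_⟩,
    fun v => ⟨(σ.symm ⟨v.1, v.2.1⟩).1, (σ.symm ⟨v.1, v.2.1⟩).2, ?_⟩, ?_, ?_⟩, ?_, ?_⟩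
  · rw [hl]; exact u.2.2
  · rw [← hl, Equiv.apply_symm_apply]; exact v.2.2
  · intro u; ext1; simp
  · intro v; ext1; simp
  · have h2 := congrArg Subtype.val h0
    exact Subtype.ext h2
  · intro u hu
    have hne : (⟨u.1, u.2.1⟩ : t.carrier) ≠ t.root := by
      intro h
      have h2 := congrArg Subtype.val h
      exact hu (Subtype.ext h2)
    have h2 := congrArg Subtype.val (h1 _ hne)
    exact Subtype.ext h2

/-! ### Elementary operations on plane trees -/

/-- The tree consisting of its root only. -/
def single : PlaneTree where
  carrier := {[]}
  root_mem := rfl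
  parent_mem u i h := by simp at h
  children u _ := ⟨0, fun i => by simp⟩

/-- The tree with two leaves attached to its root. -/
def cherry : PlaneTree where
  carrier := {[], [0], [1]}
  root_mem := by simp
  parent_mem u i h := by
    rcases u with _ | ⟨a, u⟩
    · simp
    · simp at h
  children u hu := by
    simp only [Set.mem_insert_iff, Set.mem_singleton_iff] at hu
    rcases hu with rfl | rfl | rfl
    · exact ⟨2, fun i => by simp; omega⟩
    · exact ⟨0, fun i => by simp⟩
    · exact ⟨0, fun i => by simp⟩

/-- Attach a new leaf to the vertex `u` of `t` (as its last child). -/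
noncomputable def attachLeaf (t : PlaneTree) (u : t.carrier) : PlaneTree where
  carrier := {v | v ∈ t.carrier ∨ v = u.1 ++ [t.numChildren u.1]}
  root_mem := Or.inl t.root_mem
  parent_mem v i h := by
    rcases h with h | h
    · exact Or.inl (t.parent_mem v i h)
    · exact Or.inl (by rw [(List.append_inj' h rfl).1]; exact u.2)
  children v hv := by
    by_cases hvt : v ∈ t.carrier
    · by_cases hvu : v = u.1
      · subst hvu
        refine ⟨t.numChildren u.1 + 1, fun i => ?_⟩
        simp only [Set.mem_ofPred_eq, t.mem_iff_lt_numChildren hvt, List.append_cancel_left_eq,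
          List.cons.injEq, and_true]
        omega
      · refine ⟨t.numChildren v, fun i => ?_⟩
        rw [← t.mem_iff_lt_numChildren hvt]
        refine ⟨fun h => h.resolve_right fun h => hvu (List.append_inj' h rfl).1, Or.inl⟩
    · refine ⟨0, fun i => ?_⟩
      simp only [Nat.not_lt_zero, iff_false]
      rintro (h | h)
      · exact hvt (t.parent_mem v i h)
      · exact hvt (by rw [(List.append_inj' h rfl).1]; exact u.2)

/-- Place a new vertex in the middle of the edge that ends with the vertex `u` of `t` (the phantom
edge under the root if `u` is the root) and attach a new leaf to it. The new vertex takes the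
name `u`, the sub-tree above the old vertex `u` is moved to `u 0`, and the new leaf is `u 1`. -/
def splitEdge (t : PlaneTree) (u : t.carrier) : PlaneTree where
  carrier := {v | (v ∈ t.carrier ∧ ¬ u.1 <+: v) ∨ v = u.1 ∨
    (∃ w, u.1 ++ w ∈ t.carrier ∧ v = u.1 ++ 0 :: w) ∨ v = u.1 ++ [1]}
  root_mem := by
    by_cases h : u.1 = []
    · exact Or.inr (Or.inl h.symm)
    · exact Or.inl ⟨t.root_mem, by simpa using h⟩
  parent_mem v i h := by
    rcases h with ⟨h, h'⟩ | h | ⟨w, hw, h⟩ | h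
    · exact Or.inl ⟨t.parent_mem v i h, fun hp => h' (hp.trans (List.prefix_append _ _))⟩
    · refine Or.inl ⟨t.parent_mem v i (h ▸ u.2), fun hp => ?_⟩
      have := hp.length_le
      rw [← h] at this
      simp at this
    · rcases List.eq_nil_or_concat w with rfl | ⟨w', j, rfl⟩
      · exact Or.inr (Or.inl (List.append_inj' h rfl).1)
      · refine Or.inr (Or.inr (Or.inl ⟨w', t.parent_mem _ j ?_, ?_⟩))
        · simpa using hw
        · have : v ++ [i] = (u.1 ++ 0 :: w') ++ [j] := by simpa using h
          exact (List.append_inj' this rfl).1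
    · exact Or.inr (Or.inl (List.append_inj' h rfl).1)
  children v hv := by
    by_cases hp : u.1 <+: v
    · obtain ⟨w, rfl⟩ := hp
      have key : ∀ i, (u.1 ++ w) ++ [i] ∈ {v | (v ∈ t.carrier ∧ ¬ u.1 <+: v) ∨ v = u.1 ∨
          (∃ w, u.1 ++ w ∈ t.carrier ∧ v = u.1 ++ 0 :: w) ∨ v = u.1 ++ [1]} ↔
          (∃ w', u.1 ++ w' ∈ t.carrier ∧ w ++ [i] = 0 :: w') ∨ w ++ [i] = [1] := by
        intro i
        simp
      simp only [key]
      rcases w with _ | ⟨a, w⟩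
      · refine ⟨2, fun i => ?_⟩
        simp only [List.nil_append, List.cons.injEq, and_true]
        constructor
        · rintro (⟨w', -, h, -⟩ | h) <;> omega
        · intro h
          rcases (by omega : i = 0 ∨ i = 1) with rfl | rfl
          · exact Or.inl ⟨[], by simp, rfl, rfl⟩
          · exact Or.inr rfl
      · by_cases ha : a = 0 ∧ u.1 ++ w ∈ t.carrier
        · obtain ⟨rfl, hw⟩ := ha
          refine ⟨t.numChildren (u.1 ++ w), fun i => ?_⟩
          rw [← t.mem_iff_lt_numChildren hw]
          simp
        · refine ⟨0, fun i => ?_⟩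
          simp only [Nat.not_lt_zero, iff_false]
          rintro (⟨w', hw', h⟩ | h)
          · simp only [List.cons_append, List.cons.injEq] at h
            obtain ⟨h0, rfl⟩ := h
            exact ha ⟨h0, t.parent_mem _ i (by simpa using hw')⟩
          · simp at h
    · have hvt : v ∈ t.carrier := by
        rcases hv with h | h | ⟨w, -, h⟩ | h
        · exact h.1
        · exact absurd (h ▸ List.prefix_refl _) hp
        · exact absurd (h ▸ List.prefix_append _ _) hp
        · exact absurd (h ▸ List.prefix_append _ _) hp
      refine ⟨t.numChildren v, fun i => ?_⟩
      rw [← t.mem_iff_lt_numChildren hvt]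
      constructor
      · rintro (h | h | ⟨w, hw, h⟩ | h)
        · exact h.1
        · rw [h]; exact u.2
        · exfalso
          have h2 : u.1 <+: v ++ [i] := h ▸ List.prefix_append _ _
          rcases List.prefix_concat_iff.1 h2 with h3 | h3
          · rw [← h3] at h; simpa using congrArg List.length h
          · exact hp h3
        · exact absurd ((List.append_inj' h rfl).1 ▸ List.prefix_refl _) hp
      · intro h
        by_cases h2 : u.1 <+: v ++ [i]
        · rcases List.prefix_concat_iff.1 h2 with h3 | h3
          · exact Or.inr (Or.inl h3.symm)
          · exact absurd h3 hp
        · exact Or.inl ⟨h, h2⟩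

/-- The tree obtained from the infinite branch with vertices `v_n = 0 0 ⋯ 0` (`n` letters) by
grafting at `v_n`, for every `n`, the concatenation of the trees `τ n 0, …, τ n (x n)`.
The child `0` of `v_n` is `v_{n+1}` and its child `i + 1` is the root of `τ n i`, `i ≤ x n`. -/
def spineTree (x : ℕ → ℕ) (τ : ℕ → ℕ → PlaneTree) : PlaneTree where
  carrier := {v | (∃ n, v = List.replicate n 0) ∨
    ∃ n i w, i ≤ x n ∧ w ∈ (τ n i).carrier ∧ v = List.replicate n 0 ++ (i + 1) :: w}
  root_mem := Or.inl ⟨0, rfl⟩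
  parent_mem v j h := by
    rcases h with ⟨n, h⟩ | ⟨n, i, w, hi, hw, h⟩
    · rcases n with _ | n
      · simp at h
      · rw [List.replicate_succ'] at h
        exact Or.inl ⟨n, (List.append_inj' h rfl).1⟩
    · rcases List.eq_nil_or_concat w with rfl | ⟨w', k, rfl⟩
      · exact Or.inl ⟨n, (List.append_inj' h rfl).1⟩
      · refine Or.inr ⟨n, i, w', hi, (τ n i).parent_mem _ k (by simpa using hw), ?_⟩
        have : v ++ [j] = (List.replicate n 0 ++ (i + 1) :: w') ++ [k] := by simpa using h
        exact (List.append_inj' this rfl).1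
  children v hv := by
    have inj : ∀ (n m i j : ℕ) (w w' : List ℕ), List.replicate n 0 ++ (i + 1) :: w =
        List.replicate m 0 ++ (j + 1) :: w' → n = m ∧ i = j ∧ w = w' := by
      intro n
      induction n with
      | zero => rintro (_ | m) i j w w' h <;> simp_all [List.replicate_succ]
      | succ n ih =>
        rintro (_ | m) i j w w' h
        · simp [List.replicate_succ] at h
        · simp only [List.replicate_succ, List.cons_append, List.cons.injEq, true_and] at h
          have := ih m i j w w' h
          exact ⟨by rw [this.1], this.2⟩
    have ne : ∀ (n m i : ℕ) (w : List ℕ),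
        List.replicate n 0 ++ (i + 1) :: w ≠ List.replicate m 0 := by
      intro n m i w h
      have : i + 1 ∈ List.replicate m 0 := h ▸ (by simp)
      simp at this
    rcases hv with ⟨n, rfl⟩ | ⟨n, i, w, hi, hw, rfl⟩
    · refine ⟨x n + 2, fun j => ⟨?_, fun hj => ?_⟩⟩
      · rintro (⟨m, h⟩ | ⟨m, i, w, hi, hw, h⟩)
        · rcases j with _ | j
          · omega
          · exact absurd h (ne n m j [])
        · rcases j with _ | j
          · omega
          · obtain ⟨rfl, rfl, -⟩ := inj n m j i [] w h
            omega
      · rcases j with _ | j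
        · exact Or.inl ⟨n + 1, by rw [List.replicate_succ']⟩
        · exact Or.inr ⟨n, j, [], by omega, (τ n j).root_mem, rfl⟩
    · refine ⟨(τ n i).numChildren w, fun j => ?_⟩
      rw [← (τ n i).mem_iff_lt_numChildren hw, List.append_assoc, List.cons_append]
      refine ⟨?_, fun h => Or.inr ⟨n, i, _, hi, h, rfl⟩⟩
      rintro (⟨m, h⟩ | ⟨m, i', w', hi', hw', h⟩)
      · exact absurd h (ne n m i _)
      · obtain ⟨rfl, rfl, rfl⟩ := inj _ _ _ _ _ _ h
        exact hw'

end PlaneTree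

/-- Unordered (rooted, locally finite) trees: plane trees up to equality of shapes. -/
def Tree : Type := Quotient PlaneTree.setoid

/-- The unordered tree underlying a plane tree. -/
def PlaneTree.shape (t : PlaneTree) : Tree := Quotient.mk PlaneTree.setoid t

/-! ### The local limit topology -/

namespace Tree

/-- The closed ball of radius `R` around the root of an unordered tree. -/
def ball (R : ℕ) : Tree → Tree :=
  Quotient.map (PlaneTree.ball R) fun _ _ h => PlaneTree.Equivalent.ball R h

open Classical in
/-- The local distance `exp (- inf {R ≥ 0 : t|_R ≠ s|_R})`; it is `0` if this set of radii
is empty, since the infimum is then `+∞`. -/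
noncomputable def dloc (t s : Tree) : ℝ :=
  if ∃ R, ball R t ≠ ball R s then Real.exp (-(sInf {R : ℕ | ball R t ≠ ball R s} : ℕ)) else 0

theorem ball_ball {R K : ℕ} (h : K ≤ R) (t : Tree) : ball K (ball R t) = ball K t := by
  induction t using Quotient.inductionOn with
  | h t =>
    refine congrArg (Quotient.mk PlaneTree.setoid) (PlaneTree.ext ?_)
    ext u
    exact ⟨fun hu => ⟨hu.1.1, hu.2⟩, fun hu => ⟨⟨hu.1, hu.2.trans h⟩, hu.2⟩⟩

theorem ball_eq_of_le {R K : ℕ} (h : K ≤ R) {t s : Tree} (hR : ball R t = ball R s) :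
    ball K t = ball K s := by
  rw [← ball_ball h t, hR, ball_ball h]

theorem dloc_lt_iff (t s : Tree) (R : ℕ) :
    dloc t s < Real.exp (-(R : ℝ)) ↔ ball R t = ball R s := by
  unfold dloc
  split_ifs with h
  · rw [Real.exp_lt_exp, neg_lt_neg_iff, Nat.cast_lt]
    constructor
    · intro hlt
      by_contra hne
      exact absurd (Nat.sInf_le hne) (not_le.2 hlt)
    · intro heq
      by_contra hle
      exact Nat.sInf_mem (s := {R : ℕ | ball R t ≠ ball R s}) h (ball_eq_of_le (not_lt.1 hle) heq)
  · push Not at h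
    exact ⟨fun _ => h R, fun _ => Real.exp_pos _⟩

theorem dloc_ultra (t s r : Tree) : dloc t r ≤ max (dloc t s) (dloc s r) := by
  by_contra! h
  obtain ⟨h1, h2⟩ := max_lt_iff.1 h
  have hex : ∃ R, ball R t ≠ ball R r := by
    by_contra hno
    have h0 : (0 : ℝ) ≤ dloc t s := by unfold dloc; split_ifs <;> positivity
    have h3 : dloc t r = 0 := if_neg hno
    linarith
  have hd : dloc t r = Real.exp (-(sInf {R : ℕ | ball R t ≠ ball R r} : ℕ)) := if_pos hex
  rw [hd, dloc_lt_iff] at h1 h2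
  exact Nat.sInf_mem (s := {R : ℕ | ball R t ≠ ball R r}) hex (h1.trans h2)

theorem dloc_nonneg (t s : Tree) : 0 ≤ dloc t s := by
  unfold dloc; split_ifs <;> positivity

/-- The set of trees is endowed with the local distance and the topology that it induces. -/
noncomputable instance : PseudoMetricSpace Tree where
  dist := dloc
  dist_self t := by simp [dloc]
  dist_comm t s := by
    have h : (fun R => ball R t ≠ ball R s) = fun R => ball R s ≠ ball R t :=
      funext fun R => propext ne_comm
    have h1 : (∃ R, ball R t ≠ ball R s) = ∃ R, ball R s ≠ ball R t := congrArg Exists h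
    have h2 : {R | ball R t ≠ ball R s} = {R | ball R s ≠ ball R t} := congrArg Set.ofPred h
    unfold dloc
    rw [h2]
    congr 1
  dist_triangle t s r := (dloc_ultra t s r).trans
    (max_le_add_of_nonneg (dloc_nonneg _ _) (dloc_nonneg _ _))

/-- The set of trees carries its Borel σ-algebra. -/
noncomputable instance : MeasurableSpace Tree := borel Tree

instance : BorelSpace Tree := ⟨rfl⟩

end Tree

/-! ### Finite plane trees -/

/-- Finite plane trees. They are used as representatives of finite unordered trees. -/
structure FinPlaneTree where
  tree : PlaneTree
  finite : tree.carrier.Finite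

namespace FinPlaneTree

instance : MeasurableSpace FinPlaneTree := ⊤

instance : TopologicalSpace FinPlaneTree := ⊥

instance : DiscreteTopology FinPlaneTree := ⟨rfl⟩

instance : BorelSpace FinPlaneTree := ⟨borel_eq_top_of_discrete.symm⟩

instance : Countable FinPlaneTree :=
  Function.Injective.countable (f := fun t : FinPlaneTree => t.finite.toFinset) fun t s h => by
    have h' : t.tree.carrier = s.tree.carrier := by simpa using h
    cases t; cases s
    simpa using PlaneTree.ext h'

instance (t : FinPlaneTree) : Finite t.tree.carrier := t.finite

/-- The tree consisting of its root only. -/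
def single : FinPlaneTree := ⟨PlaneTree.single, Set.finite_singleton _⟩

/-- The tree with two leaves attached to its root. -/
def cherry : FinPlaneTree := ⟨PlaneTree.cherry, by simp [PlaneTree.cherry]⟩

/-- Attach a new leaf to the vertex `u`. -/
noncomputable def attachLeaf (t : FinPlaneTree) (u : t.tree.carrier) : FinPlaneTree :=
  ⟨t.tree.attachLeaf u, (t.finite.union (Set.finite_singleton (u.1 ++ [t.tree.numChildren u.1]))).subset
    fun _ h => h⟩

/-- Place a new vertex on the edge that ends with the vertex `u` and attach a new leaf to it. -/
def splitEdge (t : FinPlaneTree) (u : t.tree.carrier) : FinPlaneTree :=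
  ⟨t.tree.splitEdge u, by
    have hu : Function.Injective fun w : List ℕ => u.1 ++ w := fun a b h => by simpa using h
    refine (t.finite.union ((Set.finite_singleton u.1).union
      (((t.finite.preimage hu.injOn).image fun w => u.1 ++ 0 :: w).union
        (Set.finite_singleton (u.1 ++ [1]))))).subset ?_
    rintro v (h | h | ⟨w, hw, h⟩ | h)
    · exact Or.inl h.1
    · exact Or.inr (Or.inl h)
    · exact Or.inr (Or.inr (Or.inl ⟨w, hw, h.symm⟩))
    · exact Or.inr (Or.inr (Or.inr h))⟩

end FinPlaneTree

/-! ### The α-γ growing trees -/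

/-- The places where the tree `t` can grow: `Sum.inl u` is the edge that ends with the vertex `u`
(the phantom edge under the root if `u` is the root), and `Sum.inr u` is the vertex `u`. -/
abbrev Place (t : FinPlaneTree) : Type := t.tree.carrier ⊕ t.tree.carrier

/-- The weights: an edge has weight `1 - α` if it ends with a leaf and `γ` otherwise, a vertex `u`
that is not a leaf has weight `(c_u(t) - 1) α - γ`, and leaves are not picked as vertices. -/
noncomputable def weight (α γ : ℝ) (t : FinPlaneTree) : Place t → ℝ
  | Sum.inl u => if t.tree.numChildren u.1 = 0 then 1 - α else γ
  | Sum.inr u => if t.tree.numChildren u.1 = 0 then 0 else ((t.tree.numChildren u.1 : ℝ) - 1) * α - γ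

/-- The tree obtained when the new leaf is inserted at a given place. -/
noncomputable def grow (t : FinPlaneTree) : Place t → FinPlaneTree
  | Sum.inl u => t.splitEdge u
  | Sum.inr u => t.attachLeaf u

open Classical in
/-- One step of the algorithm: pick a place with probability proportional to its weight and insert
a new leaf there. For the trees with `n ≥ 2` leaves that the algorithm produces, the weights are
nonnegative and their sum is `n - α > 0`; the value in the degenerate case is a convention. -/
noncomputable def growStep (α γ : ℝ) (t : FinPlaneTree) : PMF FinPlaneTree :=
  if h : ∑' p : Place t, ENNReal.ofReal (weight α γ t p) = 0 then PMF.pure t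
  else (PMF.normalize (fun p : Place t => ENNReal.ofReal (weight α γ t p)) h (by
    have := Fintype.ofFinite (Place t)
    rw [tsum_fintype]
    exact (ENNReal.sum_lt_top.2 fun _ _ => ENNReal.ofReal_lt_top).ne)).map (grow t)

/-- The law of a plane representative of the `α`-`γ` growing tree with `n` leaves, `n ≥ 1`
(the value at `n = 0` is a convention). The transitions depend on the shape of the tree only. -/
noncomputable def agPlane (α γ : ℝ) : ℕ → PMF FinPlaneTree
  | 0 => PMF.pure FinPlaneTree.single
  | 1 => PMF.pure FinPlaneTree.single
  | 2 => PMF.pure FinPlaneTree.cherry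
  | n + 3 => (agPlane α γ (n + 2)).bind (growStep α γ)

/-- The law `AG^n_{α,γ}` of the `α`-`γ` growing tree with `n` leaves, as a probability measure on
the set of unordered trees. -/
noncomputable def AG (α γ : ℝ) (n : ℕ) : ProbabilityMeasure Tree :=
  ⟨(agPlane α γ n).toMeasure.map fun t => t.tree.shape,
    Measure.isProbabilityMeasure_map (Measurable.of_discrete).aemeasurable⟩

/-! ### The infinite α-γ tree -/

/-- `P(X = n) = E[Π ^ n (1 - Π)]` where `Π` is a Beta variable with parameters `(1 - θ, θ)`. -/
noncomputable def betaGeometricMass (θ : ℝ) (n : ℕ) : ℝ≥0∞ :=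
  ∫⁻ x, ENNReal.ofReal (x ^ n * (1 - x)) ∂(betaMeasure (1 - θ) θ)

theorem tsum_betaGeometricMass {θ : ℝ} (h0 : 0 < θ) (h1 : θ < 1) :
    ∑' n, betaGeometricMass θ n = 1 := by
  unfold betaGeometricMass
  have := isProbabilityMeasureBeta (sub_pos.2 h1) h0
  rw [← lintegral_tsum (fun n => by fun_prop)]
  have hae : ∀ᵐ x ∂(betaMeasure (1 - θ) θ), 0 < x ∧ x < 1 := by
    unfold betaMeasure
    rw [ae_withDensity_iff (by unfold betaPDF; fun_prop)]
    refine Eventually.of_forall fun x hx => ?_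
    by_contra hn
    exact hx (by rw [betaPDF_eq, if_neg hn, ENNReal.ofReal_zero])
  rw [lintegral_congr_ae (g := fun _ => 1), lintegral_one, measure_univ]
  filter_upwards [hae] with x hx
  have hs := (hasSum_geometric_of_lt_one hx.1.le hx.2).mul_right (1 - x)
  rw [← ENNReal.ofReal_tsum_of_nonneg
    (fun n => mul_nonneg (pow_nonneg hx.1.le _) (sub_nonneg.2 hx.2.le)) hs.summable, hs.tsum_eq,
    inv_mul_cancel₀ (sub_pos.2 hx.2).ne', ENNReal.ofReal_one]

open Classical in
/-- The beta geometric distribution with parameters `(θ, 1 - θ)`, `0 < θ ≤ 1`: if `0 < θ < 1` it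
is the law of `X` such that, conditionally on a Beta variable `Π` with parameters `(1 - θ, θ)`,
`P(X = n | Π) = Π ^ n (1 - Π)` for all `n ≥ 0`; if `θ = 1` it is the law of `X = 0`. Other values
of `θ` are not used. -/
noncomputable def betaGeometric (θ : ℝ) : PMF ℕ :=
  if h : 0 < θ ∧ θ < 1 then
    ⟨betaGeometricMass θ, ENNReal.summable.hasSum_iff.2 (tsum_betaGeometricMass h.1 h.2)⟩
  else PMF.pure 0

/-- The joint law of a pair `(Y, τ)` where `Y` is beta geometric with parameters `(α, 1 - α)` and,
conditionally on `Y = l`, `τ` is (a plane representative of) an `α`-`γ` tree with `l + 1` leaves. -/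
noncomputable def pairLaw (α γ : ℝ) : PMF (ℕ × FinPlaneTree) :=
  (betaGeometric α).bind fun l => (agPlane α γ (l + 1)).map fun t => (l, t)

/-- The sample space for the variables `(X_n)_n` and `(Y_{n,k}, τ_{n,k})_{n,k}`. -/
abbrev Sample : Type := (ℕ → ℕ) × (ℕ × ℕ → ℕ × FinPlaneTree)

/-- Under this measure, the variables `X_n` are i.i.d. beta geometric with parameters
`(γ / α, 1 - γ / α)`, the pairs `(Y_{n,k}, τ_{n,k})` are i.i.d. with law `pairLaw α γ`, and these
two families are independent. -/
noncomputable def sampleMeasure (α γ : ℝ) : Measure Sample :=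
  (Measure.infinitePi fun _ : ℕ => (betaGeometric (γ / α)).toMeasure).prod
    (Measure.infinitePi fun _ : ℕ × ℕ => (pairLaw α γ).toMeasure)

/-- The tree `T_∞` obtained by grafting, for each `n ≥ 0`, the concatenation of the trees
`τ_{n,i}`, `0 ≤ i ≤ X_n`, at height `n` on an infinite branch. -/
def infiniteTree (ω : Sample) : Tree :=
  (PlaneTree.spineTree ω.1 fun n i => (ω.2 (n, i)).2.tree).shape

theorem continuous_infiniteTree : Continuous infiniteTree := by
  rw [continuous_iff_continuousAt]
  intro ω
  rw [ContinuousAt, Metric.tendsto_nhds]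
  intro ε hε
  obtain ⟨R, hR⟩ : ∃ R : ℕ, Real.exp (-(R : ℝ)) < ε :=
    ((Real.tendsto_exp_neg_atTop_nhds_zero.comp tendsto_natCast_atTop_atTop).eventually
      (gt_mem_nhds hε)).exists
  have hX : ∀ n : ℕ, ∀ᶠ ω' in 𝓝 ω, ω'.1 n = ω.1 n := fun n =>
    (((continuous_apply n).comp continuous_fst).tendsto ω).eventually
      (show ∀ᶠ y in 𝓝 (ω.1 n), y = ω.1 n by rw [nhds_discrete]; rfl)
  have hτ : ∀ q : ℕ × ℕ, ∀ᶠ ω' in 𝓝 ω, ω'.2 q = ω.2 q := fun q =>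
    (((continuous_apply q).comp continuous_snd).tendsto ω).eventually
      (show ∀ᶠ y in 𝓝 (ω.2 q), y = ω.2 q by rw [nhds_discrete]; rfl)
  have h1 : ∀ᶠ ω' in 𝓝 ω, ∀ n ∈ Finset.range (R + 1), ω'.1 n = ω.1 n :=
    (Filter.eventually_all_finset _).2 fun n _ => hX n
  have h2 : ∀ᶠ ω' in 𝓝 ω, ∀ n ∈ Finset.range (R + 1), ∀ i ∈ Finset.range (ω.1 n + 1),
      ω'.2 (n, i) = ω.2 (n, i) :=
    (Filter.eventually_all_finset _).2 fun n _ =>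
      (Filter.eventually_all_finset _).2 fun i _ => hτ (n, i)
  filter_upwards [h1, h2] with ω' h1 h2
  refine lt_trans ((Tree.dloc_lt_iff _ _ R).2 ?_) hR
  refine congrArg (Quotient.mk PlaneTree.setoid) (PlaneTree.ext ?_)
  ext v
  constructor
  · rintro ⟨h | ⟨n, i, w, hi, hw, h⟩, hl⟩
    · exact ⟨Or.inl h, hl⟩
    · have hn : n ∈ Finset.range (R + 1) := by
        have := congrArg List.length h
        simp at this ⊢
        omega
      rw [h1 n hn] at hi
      refine ⟨Or.inr ⟨n, i, w, hi, ?_, h⟩, hl⟩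
      have h3 := h2 n hn i (by simp; omega)
      simpa only [h3] using hw
  · rintro ⟨h | ⟨n, i, w, hi, hw, h⟩, hl⟩
    · exact ⟨Or.inl h, hl⟩
    · have hn : n ∈ Finset.range (R + 1) := by
        have := congrArg List.length h
        simp at this ⊢
        omega
      refine ⟨Or.inr ⟨n, i, w, by rw [h1 n hn]; exact hi, ?_, h⟩, hl⟩
      have h3 := h2 n hn i (by simp; omega)
      simpa only [h3] using hw

theorem measurable_infiniteTree : Measurable infiniteTree := continuous_infiniteTree.measurable

instance (α γ : ℝ) : IsProbabilityMeasure (sampleMeasure α γ) := by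
  unfold sampleMeasure; infer_instance

/-- The law `AG^∞_{α,γ}` of the infinite `α`-`γ` tree. -/
noncomputable def AGInfty (α γ : ℝ) : ProbabilityMeasure Tree :=
  ⟨(sampleMeasure α γ).map infiniteTree,
    Measure.isProbabilityMeasure_map measurable_infiniteTree.aemeasurable⟩

end AlphaGamma

/-! The growing tree and the infinite tree are both decomposed at the root, and the comparison goes
by induction on the radius of the ball. One subtree above the root is distinguished: when the
phantom edge is split, it is the whole old tree and the new leaf is its only sibling. Conditionally
on the sizes, the subtrees above the root are independent growing trees (`MarkovBranching`), because
the places of a tree are the root edge, the root vertex and the places of its subtrees, and a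
subtree with `l` leaves has total weight `l - α`. This identity and the total weight `n - α` are
proved by one joint induction.

The sizes `s` of the siblings form a Markov chain with an explicit generator. For a functional
supported on lists of sum `M`, its expectation `x k` satisfies `(k + 2 - α) x (k + 1) = (k + 2 - M -
α) x k + b k`, where `b k` involves only lists of sum `M - 1`. By induction on `M`, `b k` has a
limit `B`, so `x k` tends to `B / M` (`tendsto_of_recurrence`). The limit is the law of the bush
sizes on the infinite branch, since that law solves the balance equation
`expect_bushSizes_stationary`; this in turn rests on the ratio of consecutive beta geometric masses.

Thus the siblings keep a finite limiting size while the distinguished subtree is a growing tree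
whose size tends to infinity. The infinite tree solves the corresponding recursive equation: its
distinguished subtree is an independent copy of itself (`lintegral_infiniteTree`). Replacing this
subtree by its limit lowers the radius by one. Only lower bounds on lower limits are needed, by the
portmanteau theorem for open sets, so monotone convergence suffices and no tightness argument
appears. -/

open MeasureTheory ProbabilityTheory Filter Topology
open scoped ENNReal

namespace AlphaGamma

/-! ### Expectations with respect to probability mass functions -/

/-- The expectation of `f` under the probability mass function `p`. -/
noncomputable def expect {A : Type*} (p : PMF A) (f : A → ℝ≥0∞) : ℝ≥0∞ := ∑' a, p a * f a

section Expect

variable {A B : Type*}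

theorem expect_pure (a : A) (f : A → ℝ≥0∞) : expect (PMF.pure a) f = f a := by
  rw [expect, tsum_eq_single a (fun b hb => by simp [hb])]
  simp

theorem expect_bind (p : PMF A) (q : A → PMF B) (f : B → ℝ≥0∞) :
    expect (p.bind q) f = expect p fun a => expect (q a) f := by
  simp only [expect, PMF.bind_apply, ← ENNReal.tsum_mul_right, ← ENNReal.tsum_mul_left]
  rw [ENNReal.tsum_comm]
  simp only [mul_assoc]

theorem expect_map (p : PMF A) (g : A → B) (f : B → ℝ≥0∞) :
    expect (p.map g) f = expect p fun a => f (g a) := by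
  rw [← PMF.bind_pure_comp, expect_bind]
  simp [expect_pure]

theorem expect_const (p : PMF A) (c : ℝ≥0∞) : expect p (fun _ => c) = c := by
  rw [expect, ENNReal.tsum_mul_right, p.tsum_coe, one_mul]

theorem expect_mono (p : PMF A) {f g : A → ℝ≥0∞} (h : ∀ a ∈ p.support, f a ≤ g a) :
    expect p f ≤ expect p g :=
  ENNReal.tsum_le_tsum fun a => by
    by_cases ha : a ∈ p.support
    · exact mul_le_mul_right (h a ha) _
    · rw [PMF.mem_support_iff, not_not] at ha
      simp [ha]

theorem expect_congr (p : PMF A) {f g : A → ℝ≥0∞} (h : ∀ a ∈ p.support, f a = g a) :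
    expect p f = expect p g :=
  (expect_mono p fun a ha => (h a ha).le).antisymm (expect_mono p fun a ha => (h a ha).ge)

theorem expect_le (p : PMF A) {f : A → ℝ≥0∞} {c : ℝ≥0∞} (h : ∀ a, f a ≤ c) : expect p f ≤ c :=
  (expect_mono p fun a _ => h a).trans (expect_const p c).le

theorem expect_add (p : PMF A) (f g : A → ℝ≥0∞) :
    expect p (fun a => f a + g a) = expect p f + expect p g := by
  simp only [expect, mul_add, ENNReal.tsum_add]

theorem expect_const_mul (p : PMF A) (c : ℝ≥0∞) (f : A → ℝ≥0∞) :
    expect p (fun a => c * f a) = c * expect p f := by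
  simp only [expect, ← ENNReal.tsum_mul_left]
  exact tsum_congr fun a => mul_left_comm _ _ _

theorem expect_comm (p : PMF A) (q : PMF B) (f : A → B → ℝ≥0∞) :
    expect p (fun a => expect q fun b => f a b) = expect q fun b => expect p fun a => f a b := by
  simp only [expect, ← ENNReal.tsum_mul_left]
  rw [ENNReal.tsum_comm]
  exact tsum_congr fun b => tsum_congr fun a => mul_left_comm _ _ _

/-- Encodes almost sure properties as vanishing expectations, so that an identity between
expectations transports them from one law to another. -/
theorem mem_support_iff_expect (p : PMF A) (P : A → Prop) [DecidablePred P] :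
    expect p (fun a => if P a then 0 else 1) = 0 ↔ ∀ a ∈ p.support, P a := by
  rw [expect, ENNReal.tsum_eq_zero]
  refine forall_congr' fun a => ?_
  rw [PMF.mem_support_iff]
  by_cases h : P a <;> simp [h]

/-- Monotone convergence, with the sum read as an integral against counting measure. -/
theorem expect_iSup (p : PMF A) {f : ℕ → A → ℝ≥0∞} (h : Monotone f) :
    expect p (fun a => ⨆ n, f n a) = ⨆ n, expect p (f n) := by
  let _ : MeasurableSpace A := ⊤
  simp only [expect, ENNReal.mul_iSup, ← lintegral_count]
  refine lintegral_iSup (fun n => measurable_from_top) fun n m hnm a => ?_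
  exact mul_le_mul_right (h hnm a) _

theorem lintegral_toMeasure [MeasurableSpace A] [DiscreteMeasurableSpace A] [Countable A]
    (p : PMF A) (f : A → ℝ≥0∞) : ∫⁻ a, f a ∂p.toMeasure = expect p f := by
  rw [lintegral_countable']
  refine tsum_congr fun a => ?_
  rw [p.toMeasure_apply_singleton a (MeasurableSet.singleton a), mul_comm]

end Expect

/-! ### Random lists -/

/-- The law of a list of independent variables whose laws are listed. -/
noncomputable def indepList {A : Type*} : List (PMF A) → PMF (List A)
  | [] => PMF.pure []
  | p :: ps => p.bind fun a => (indepList ps).map fun s => a :: s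

theorem expect_indepList_nil {A : Type*} (f : List A → ℝ≥0∞) : expect (indepList []) f = f [] :=
  expect_pure _ _

theorem expect_indepList_cons {A : Type*} (p : PMF A) (ps : List (PMF A)) (f : List A → ℝ≥0∞) :
    expect (indepList (p :: ps)) f =
      expect p fun a => expect (indepList ps) fun s => f (a :: s) := by
  simp only [indepList, expect_bind, expect_map]

/-- The length is deterministic, so factors that depend on it can be pulled out of the expectation.
-/
theorem expect_indepList_length {A : Type*} (ps : List (PMF A)) (g : ℕ → List A → ℝ≥0∞) :
    expect (indepList ps) (fun s => g s.length s) = expect (indepList ps) (g ps.length) := by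
  induction ps generalizing g with
  | nil => simp [expect_indepList_nil]
  | cons p ps ih =>
    simp only [expect_indepList_cons, List.length_cons]
    exact expect_congr _ fun a _ => ih fun k s => g (k + 1) (a :: s)

theorem expect_indepList_concat_pure {A : Type*} (ps : List (PMF A)) (a : A)
    (f : List A → ℝ≥0∞) : expect (indepList (ps ++ [PMF.pure a])) f =
      expect (indepList ps) fun s => f (s ++ [a]) := by
  induction ps generalizing f with
  | nil => simp [expect_indepList_cons, expect_indepList_nil, expect_pure]
  | cons p ps ih => simp only [List.cons_append, expect_indepList_cons, ih]

/-- A functional of lists that does not depend on the order of their entries. -/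
def PermInvariant {A B : Type*} (f : List A → B) : Prop := ∀ s s', s.Perm s' → f s = f s'

theorem PermInvariant.cons {A B : Type*} {f : List A → B} (h : PermInvariant f) (a : A) :
    PermInvariant fun s => f (a :: s) := fun _ _ hs => h _ _ (hs.cons a)

theorem PermInvariant.swap {A B : Type*} {f : List A → B} (h : PermInvariant f) (a b : A)
    (s : List A) : f (a :: b :: s) = f (b :: a :: s) := h _ _ (List.Perm.swap _ _ _)

theorem permInvariant_expect_indepList {A : Type*} {f : List A → ℝ≥0∞} (hf : PermInvariant f) :
    PermInvariant fun ps => expect (indepList ps) f := by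
  intro ps ps' h
  induction h generalizing f with
  | nil => rfl
  | cons p _ ih =>
    simp only [expect_indepList_cons]
    exact expect_congr _ fun a _ => ih (hf.cons a)
  | swap p q ps =>
    simp only [expect_indepList_cons]
    rw [expect_comm]
    simp only [hf.swap]
  | trans _ _ h1 h2 => exact (h1 hf).trans (h2 hf)

/-- The law of a list of `n` independent variables with law `p`. -/
noncomputable def iidList {A : Type*} (p : PMF A) (n : ℕ) : PMF (List A) :=
  indepList (List.replicate n p)

theorem expect_iidList_zero {A : Type*} (p : PMF A) (f : List A → ℝ≥0∞) :
    expect (iidList p 0) f = f [] := expect_indepList_nil f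

theorem expect_iidList_succ {A : Type*} (p : PMF A) (n : ℕ) (f : List A → ℝ≥0∞) :
    expect (iidList p (n + 1)) f = expect p fun a => expect (iidList p n) fun s => f (a :: s) :=
  expect_indepList_cons p _ f

theorem expect_iidList_length {A : Type*} (p : PMF A) (n : ℕ) (g : ℕ → List A → ℝ≥0∞) :
    expect (iidList p n) (fun s => g s.length s) = expect (iidList p n) (g n) := by
  rw [iidList, expect_indepList_length, List.length_replicate]

/-- By exchangeability each of the `n + 1` positions contributes equally to the count, and the entry
equal to `c` may be moved to the front. -/
theorem expect_iidList_count (p : PMF ℕ) (n c : ℕ) {F : List ℕ → ℝ≥0∞}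
    (hF : PermInvariant F) :
    expect (iidList p (n + 1)) (fun s => (s.count c : ℝ≥0∞) * F s) =
      (n + 1) * (p c * expect (iidList p n) fun s => F (c :: s)) := by
  -- The first entry is isolated: it contributes one to the count when it equals `c`, and the rest
  -- of the count lives on the tail.
  have key : ∀ m (F : List ℕ → ℝ≥0∞), expect (iidList p (m + 1)) (fun s => (s.count c : ℝ≥0∞) * F s) =
      p c * expect (iidList p m) (fun s => F (c :: s)) +
        expect p fun l => expect (iidList p m) fun s => (s.count c : ℝ≥0∞) * F (l :: s) := by
    intro m F
    have : ∀ l, expect (iidList p m) (fun s => (((l :: s).count c : ℕ) : ℝ≥0∞) * F (l :: s)) =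
        (if l = c then expect (iidList p m) (fun s => F (c :: s)) else 0) +
          expect (iidList p m) fun s => (s.count c : ℝ≥0∞) * F (l :: s) := by
      intro l
      split_ifs with h
      · subst h
        rw [← expect_add]
        refine expect_congr _ fun s _ => ?_
        simp only [List.count_cons_self, Nat.cast_add, Nat.cast_one]
        ring
      · rw [zero_add]
        refine expect_congr _ fun s _ => ?_
        rw [List.count_cons_of_ne h]
    rw [expect_iidList_succ]
    simp only [this, expect_add]
    congr 1
    rw [expect, tsum_eq_single c (fun b hb => by simp [hb])]
    simp
  induction n generalizing F with
  | zero =>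
    rw [key]
    simp [expect_iidList_zero, expect_const]
  | succ n ih =>
    rw [key]
    have : ∀ l, expect (iidList p (n + 1)) (fun s => (s.count c : ℝ≥0∞) * F (l :: s)) =
        (n + 1) * (p c * expect (iidList p n) fun s => F (c :: l :: s)) := by
      intro l
      rw [ih (hF.cons l)]
      simp only [hF.swap l c]
    simp only [this]
    rw [expect_const_mul, expect_const_mul, ← expect_iidList_succ p n fun s => F (c :: s)]
    push_cast
    ring

/-! ### Incrementing an entry of a list -/

/-- The sum over the entries `l` of a list of `l - α` times the value of `F` at the list in which
this entry is replaced by `l + 1`. -/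
noncomputable def incr (α : ℝ) : (List ℕ → ℝ≥0∞) → List ℕ → ℝ≥0∞
  | _, [] => 0
  | F, l :: s => ENNReal.ofReal (l - α) * F ((l + 1) :: s) + incr α (fun s' => F (l :: s')) s

theorem incr_expect {A : Type*} (α : ℝ) (p : PMF A) (F : A → List ℕ → ℝ≥0∞) (s : List ℕ) :
    incr α (fun s' => expect p fun a => F a s') s = expect p fun a => incr α (F a) s := by
  induction s generalizing F with
  | nil => simp [incr, expect_const]
  | cons l s ih =>
    simp only [incr, expect_add, expect_const_mul]
    rw [ih]

/-- `incr` reads its functional only at lists of the same length with sum larger by one, so the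
comparison is required only there. -/
theorem incr_mono {α : ℝ} {F F' : List ℕ → ℝ≥0∞} {s : List ℕ} (hs : ∀ l ∈ s, 1 ≤ l)
    (h : ∀ s', s'.sum = s.sum + 1 → (∀ l ∈ s', 1 ≤ l) → s'.length = s.length → F s' ≤ F' s') :
    incr α F s ≤ incr α F' s := by
  induction s generalizing F F' with
  | nil => simp [incr]
  | cons l s ih =>
    simp only [List.mem_cons, forall_eq_or_imp] at hs
    refine add_le_add (mul_le_mul_right (h _ ?_ ?_ (by simp)) _) (ih hs.2 fun s' h1 h2 h3 => ?_)
    · simp; omega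
    · simpa using hs.2
    · exact h _ (by simp [h1]; omega) (by simpa using ⟨hs.1, h2⟩) (by simp [h3])

theorem PermInvariant.incr {α : ℝ} {F : List ℕ → ℝ≥0∞} (hF : PermInvariant F) :
    PermInvariant (incr α F) := by
  intro s s' h
  induction h generalizing F with
  | nil => rfl
  | cons l h ih =>
    simp only [AlphaGamma.incr]
    rw [hF _ _ (h.cons (l + 1)), ih (hF.cons l)]
  | swap a b s =>
    simp only [AlphaGamma.incr, hF.swap b, hF.swap (b + 1)]
    ring
  | trans _ _ h1 h2 => exact (h1 hF).trans (h2 hF)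

theorem incr_ne_top {α : ℝ} {F : List ℕ → ℝ≥0∞} (hF : ∀ s, F s ≠ ∞) (s : List ℕ) :
    incr α F s ≠ ∞ := by
  induction s generalizing F with
  | nil => simp [incr]
  | cons l s ih =>
    exact ENNReal.add_ne_top.2 ⟨ENNReal.mul_ne_top ENNReal.ofReal_ne_top (hF _), ih fun s => hF _⟩

theorem incr_add (α : ℝ) (F F' : List ℕ → ℝ≥0∞) (s : List ℕ) :
    incr α (fun s => F s + F' s) s = incr α F s + incr α F' s := by
  induction s generalizing F F' with
  | nil => simp [incr]
  | cons l s ih => simp only [incr, ih]; ring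

/-! ### Beta geometric laws -/

/-- Multiplying the Beta density with parameters `(1 - θ, θ)` by `x ^ n * (1 - x)` gives a multiple
of the density with parameters `(n + 1 - θ, θ + 1)`; the mass is the ratio of the normalising
constants. -/
theorem betaGeometricMass_eq {θ : ℝ} (h0 : 0 < θ) (h1 : θ < 1) (n : ℕ) :
    betaGeometricMass θ n = ENNReal.ofReal (beta (n + 1 - θ) (θ + 1) / beta (1 - θ) θ) := by
  have hn : 0 < (n : ℝ) + 1 - θ := by have := n.cast_nonneg (α := ℝ); linarith
  have hb := beta_pos hn (add_pos h0 one_pos)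
  have hb' := beta_pos (sub_pos.2 h1) h0
  rw [← mul_one (ENNReal.ofReal _), ← lintegral_betaPDF_eq_one hn (add_pos h0 one_pos),
    ← lintegral_const_mul _ (by unfold betaPDF; fun_prop), betaGeometricMass, betaMeasure,
    lintegral_withDensity_eq_lintegral_mul _ (by unfold betaPDF; fun_prop) (by fun_prop)]
  refine lintegral_congr fun x => ?_
  rw [Pi.mul_apply, betaPDF_eq, betaPDF_eq]
  split_ifs with hx
  · have hx1 : 0 < 1 - x := sub_pos.2 hx.2
    rw [← ENNReal.ofReal_mul (by have := hx.1; positivity), ← ENNReal.ofReal_mul (by positivity)]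
    congr 1
    rw [show (n : ℝ) + 1 - θ - 1 = (1 - θ - 1) + n by ring, Real.rpow_add_natCast hx.1.ne',
      show θ + 1 - 1 = (θ - 1) + (1 : ℕ) by push_cast; ring, Real.rpow_add_natCast hx1.ne']
    field_simp
  · simp

theorem betaGeometric_apply {θ : ℝ} (h0 : 0 < θ) (h1 : θ < 1) (n : ℕ) :
    betaGeometric θ n = betaGeometricMass θ n := by
  have : betaGeometric θ =
      (⟨betaGeometricMass θ, ENNReal.summable.hasSum_iff.2 (tsum_betaGeometricMass h0 h1)⟩ : PMF ℕ) :=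
    dif_pos ⟨h0, h1⟩
  rw [this]
  rfl

theorem betaGeometric_zero {θ : ℝ} (h0 : 0 < θ) (h1 : θ ≤ 1) :
    betaGeometric θ 0 = ENNReal.ofReal θ := by
  rcases h1.lt_or_eq with h1 | rfl
  · rw [betaGeometric_apply h0 h1, betaGeometricMass_eq h0 h1]
    congr 1
    have hG := Real.Gamma_pos_of_pos (sub_pos.2 h1)
    have hG' := Real.Gamma_pos_of_pos h0
    simp only [beta, Nat.cast_zero, zero_add, Real.Gamma_add_one h0.ne']
    rw [show 1 - θ + (θ + 1) = 1 + 1 by ring, show 1 - θ + θ = 1 by ring,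
      Real.Gamma_add_one one_ne_zero, Real.Gamma_one]
    field_simp
  · simp [betaGeometric]

/-- Follows from the functional equation of Gamma. With the mass at `0`, it is all that the sequel
uses about the individual masses. For `θ = 1` both sides vanish. -/
theorem betaGeometric_succ {θ : ℝ} (h0 : 0 < θ) (h1 : θ ≤ 1) (n : ℕ) :
    (n + 2) * betaGeometric θ (n + 1) = ENNReal.ofReal (n + 1 - θ) * betaGeometric θ n := by
  rcases h1.lt_or_eq with h1 | rfl
  · have hn : 0 < (n : ℝ) + 1 - θ := by have := n.cast_nonneg (α := ℝ); linarith
    have h2 : ((n : ℝ≥0∞) + 2) = ENNReal.ofReal (n + 2) := by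
      rw [ENNReal.ofReal_add (by positivity) (by positivity)]; simp
    rw [betaGeometric_apply h0 h1, betaGeometric_apply h0 h1, betaGeometricMass_eq h0 h1,
      betaGeometricMass_eq h0 h1, h2,
      ← ENNReal.ofReal_mul (by positivity), ← ENNReal.ofReal_mul hn.le]
    congr 1
    have hG := Real.Gamma_pos_of_pos (show (0 : ℝ) < n + 2 by positivity)
    simp only [beta]
    rw [show ((n + 1 : ℕ) : ℝ) + 1 - θ = (n + 1 - θ) + 1 by push_cast; ring,
      Real.Gamma_add_one hn.ne', show (n : ℝ) + 1 - θ + 1 + (θ + 1) = (n + 2) + 1 by ring,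
      show (n : ℝ) + 1 - θ + (θ + 1) = n + 2 by ring, Real.Gamma_add_one (s := (n : ℝ) + 2) (by positivity)]
    field_simp
  · rcases n with _ | n <;> simp [betaGeometric]

/-- The law of `Y + 1`, where `Y` is beta geometric with parameters `(θ, 1 - θ)`. -/
noncomputable def sibuya (θ : ℝ) : PMF ℕ := (betaGeometric θ).map fun y => y + 1

theorem sibuya_one {θ : ℝ} (h0 : 0 < θ) (h1 : θ ≤ 1) : sibuya θ 1 = ENNReal.ofReal θ := by
  rw [sibuya, PMF.map_apply, tsum_eq_single 0]
  · rw [if_pos rfl, betaGeometric_zero h0 h1]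
  · intro b hb
    rw [if_neg (by omega)]

/-- The masses satisfy `(l - α) p(l) = (l + 1) p(l + 1)`; shifting the summation index by one leaves
the weight `l` at every `l` except `1`, which is not reached by the shift. -/
theorem expect_sibuya_incr {α : ℝ} (h0 : 0 < α) (h1 : α ≤ 1) (H : ℕ → ℝ≥0∞) :
    expect (sibuya α) (fun l => ENNReal.ofReal (l - α) * H (l + 1)) =
      expect (sibuya α) fun l => ((if l = 1 then 0 else l : ℕ) : ℝ≥0∞) * H l := by
  rw [sibuya, expect_map, expect_map]
  rw [expect, expect]
  conv_rhs => rw [tsum_eq_zero_add' ENNReal.summable]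
  simp only [zero_add, if_true, Nat.cast_zero, zero_mul, mul_zero]
  refine tsum_congr fun y => ?_
  rw [if_neg (by omega), ← mul_assoc, ← mul_assoc]
  congr 1
  have := betaGeometric_succ h0 h1 y
  push_cast
  rw [mul_comm, ← this, mul_comm, add_assoc]
  norm_num

theorem expect_iidList_incr {α : ℝ} (h0 : 0 < α) (h1 : α ≤ 1) (n : ℕ) (F : List ℕ → ℝ≥0∞) :
    expect (iidList (sibuya α) n) (incr α F) =
      expect (iidList (sibuya α) n) fun s =>
        (((s.map fun l => if l = 1 then 0 else l).sum : ℕ) : ℝ≥0∞) * F s := by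
  induction n generalizing F with
  | zero => simp [expect_iidList_zero, incr]
  | succ n ih =>
    simp only [expect_iidList_succ, incr, expect_add, expect_const_mul, ih, List.map_cons,
      List.sum_cons, Nat.cast_add, add_mul]
    congr 1
    exact expect_sibuya_incr h0 h1 fun l => expect (iidList (sibuya α) n) fun s => F (l :: s)

theorem sum_eq_sum_add_count (s : List ℕ) :
    s.sum = (s.map fun l => if l = 1 then 0 else l).sum + s.count 1 := by
  induction s with
  | nil => rfl
  | cons l s ih =>
    simp only [List.sum_cons, List.map_cons, List.count_cons, beq_iff_eq, ih]
    split_ifs <;> omega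

/-! ### The sizes of the bushes at a vertex of the infinite branch -/

/-- The law of the sizes of the trees grafted at a vertex of the infinite branch. -/
noncomputable def bushSizes (α γ : ℝ) : PMF (List ℕ) :=
  (betaGeometric (γ / α)).bind fun x => iidList (sibuya α) (x + 1)

theorem expect_bushSizes (α γ : ℝ) (F : List ℕ → ℝ≥0∞) :
    expect (bushSizes α γ) F =
      expect (betaGeometric (γ / α)) fun x => expect (iidList (sibuya α) (x + 1)) F :=
  expect_bind _ _ _

/-- Conditioning on the number of bushes, exchangeability brings an entry `1`, of mass `α`, to the
front. A single bush gives `(γ / α) * α = γ`, and `x + 2` bushes match the left term with `x + 1`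
bushes by `betaGeometric_succ` with `θ = γ / α`. -/
theorem expect_bushSizes_append {α γ : ℝ} (hγ : 0 < γ) (hγα : γ ≤ α) (hα : α ≤ 1)
    {F : List ℕ → ℝ≥0∞} (hF : PermInvariant F) :
    ENNReal.ofReal γ * F [1] + expect (bushSizes α γ)
      (fun s => ENNReal.ofReal (s.length * α - γ) * F (s ++ [1])) =
      expect (bushSizes α γ) fun s => (s.count 1 : ℝ≥0∞) * F s := by
  have h0 : 0 < α := hγ.trans_le hγα
  have hθ : 0 < γ / α := div_pos hγ h0
  have hθ1 : γ / α ≤ 1 := (div_le_one h0).2 hγα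
  rw [expect_bushSizes, expect_bushSizes]
  simp only [expect_iidList_count _ _ _ hF, sibuya_one h0 hα]
  rw [expect, expect]
  conv_rhs => rw [tsum_eq_zero_add' ENNReal.summable]
  congr 1
  · rw [betaGeometric_zero hθ hθ1, expect_iidList_zero, Nat.cast_zero, zero_add, one_mul,
      ← mul_assoc, ← ENNReal.ofReal_mul hθ.le, div_mul_cancel₀ _ h0.ne']
  · refine tsum_congr fun x => ?_
    have hx : expect (iidList (sibuya α) (x + 1))
        (fun s => ENNReal.ofReal (s.length * α - γ) * F (s ++ [1])) =
        ENNReal.ofReal ((x + 1) * α - γ) * expect (iidList (sibuya α) (x + 1))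
          fun s => F (1 :: s) := by
      rw [expect_iidList_length _ _ fun n s => ENNReal.ofReal (n * α - γ) * F (s ++ [1]),
        expect_const_mul]
      push_cast
      congr 1
      exact expect_congr _ fun s _ => hF _ _ (List.perm_append_singleton 1 s)
    have hb := betaGeometric_succ hθ hθ1 x
    rw [hx, show (x + 1) * α - γ = (x + 1 - γ / α) * α by field_simp,
      ENNReal.ofReal_mul' h0.le]
    push_cast
    calc _ = (ENNReal.ofReal (x + 1 - γ / α) * betaGeometric (γ / α) x) *
          (ENNReal.ofReal α * expect (iidList (sibuya α) (x + 1)) fun s => F (1 :: s)) := by ring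
      _ = _ := by rw [← hb]; ring

/-- Balance equation for the sizes next to the distinguished subtree. Growth of an existing bush
accounts for the entries different from `1` in the sum, and the creation of a one-leaf bush for the
entries equal to `1`. -/
theorem expect_bushSizes_stationary {α γ : ℝ} (hγ : 0 < γ) (hγα : γ ≤ α) (hα : α ≤ 1)
    {F : List ℕ → ℝ≥0∞} (hF : PermInvariant F) :
    ENNReal.ofReal γ * F [1] + expect (bushSizes α γ)
      (fun s => incr α F s + ENNReal.ofReal (s.length * α - γ) * F (s ++ [1])) =
      expect (bushSizes α γ) fun s => (s.sum : ℝ≥0∞) * F s := by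
  have h0 : 0 < α := hγ.trans_le hγα
  rw [expect_add, add_left_comm, expect_bushSizes_append hγ hγα hα hF, expect_bushSizes α γ (incr α F)]
  simp only [expect_iidList_incr h0 hα]
  rw [← expect_bushSizes α γ (fun s => (((s.map fun l => if l = 1 then 0 else l).sum : ℕ) : ℝ≥0∞) * F s),
    ← expect_add]
  refine expect_congr _ fun s _ => ?_
  rw [← add_mul, ← Nat.cast_add, ← sum_eq_sum_add_count]

theorem expect_bushSizes_eq_zero {α γ : ℝ} {F : List ℕ → ℝ≥0∞} (hF : ∀ s, s.sum ≠ 0 → F s = 0) :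
    expect (bushSizes α γ) F = 0 := by
  have : ∀ y x, expect (iidList (sibuya α) x) (fun s => F ((y + 1) :: s)) = 0 := fun y x => by
    rw [← expect_const (iidList (sibuya α) x) 0]
    exact expect_congr _ fun s _ => hF _ (by simp)
  simp only [expect_bushSizes, expect_iidList_succ]
  simp only [sibuya, expect_map] at *
  simp only [this, expect_const]

/-! ### The sizes of the subtrees above the root of a growing tree -/

theorem incr_const_mul (α : ℝ) (c : ℝ≥0∞) (F : List ℕ → ℝ≥0∞) (s : List ℕ) :
    incr α (fun s => c * F s) s = c * incr α F s := by
  induction s generalizing F with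
  | nil => simp [incr]
  | cons l s ih => simp only [incr, ih]; ring

/-- The generator of the sizes of the subtrees above the root, except the first one, for a tree
with `k + 2` leaves: the first subtree grows, or another one does, or a leaf is attached to the
root. -/
noncomputable def sizesGenerator (α γ : ℝ) (k : ℕ) (F : List ℕ → ℝ≥0∞) (s : List ℕ) : ℝ≥0∞ :=
  ENNReal.ofReal (k + 2 - s.sum - α) * F s +
    (incr α F s + ENNReal.ofReal (s.length * α - γ) * F (s ++ [1]))

/-- The expectation of `F` at the sizes of the subtrees above the root, except the first one, in
the growing tree with `k + 2` leaves. -/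
noncomputable def sizesExpect (α γ : ℝ) : ℕ → (List ℕ → ℝ≥0∞) → ℝ≥0∞
  | 0, F => F [1]
  | k + 1, F => (ENNReal.ofReal (k + 2 - α))⁻¹ *
      (ENNReal.ofReal γ * F [1] + sizesExpect α γ k (sizesGenerator α γ k F))

/-- With `k + 2` leaves the distinguished subtree keeps at least one leaf and has a sibling, so only
nonempty lists of positive sizes with sum at most `k + 1` are charged. Off these lists the
truncation in `ENNReal.ofReal` is irrelevant. -/
theorem sizesExpect_mono {α γ : ℝ} {k : ℕ} {F F' : List ℕ → ℝ≥0∞}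
    (h : ∀ s, s ≠ [] → (∀ l ∈ s, 1 ≤ l) → s.sum ≤ k + 1 → F s ≤ F' s) :
    sizesExpect α γ k F ≤ sizesExpect α γ k F' := by
  induction k generalizing F F' with
  | zero => exact h [1] (by simp) (by simp) (by simp)
  | succ k ih =>
    refine mul_le_mul_right (add_le_add (mul_le_mul_right (h [1] (by simp) (by simp) (by simp)) _)
      (ih fun s h0 h1 h2 => ?_)) _
    refine add_le_add (mul_le_mul_right (h s h0 h1 (by omega)) _)
      (add_le_add (incr_mono h1 fun s' h3 h4 h5 => h s' ?_ h4 (by omega))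
        (mul_le_mul_right (h _ (by simp) ?_ (by simp; omega)) _))
    · rintro rfl
      exact h0 (List.length_eq_zero_iff.1 h5.symm)
    · intro l hl
      rcases List.mem_append.1 hl with hl | hl
      · exact h1 l hl
      · simp_all

theorem sizesExpect_congr {α γ : ℝ} {k : ℕ} {F F' : List ℕ → ℝ≥0∞}
    (h : ∀ s, s ≠ [] → (∀ l ∈ s, 1 ≤ l) → s.sum ≤ k + 1 → F s = F' s) :
    sizesExpect α γ k F = sizesExpect α γ k F' :=
  (sizesExpect_mono fun s h0 h1 h2 => (h s h0 h1 h2).le).antisymm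
    (sizesExpect_mono fun s h0 h1 h2 => (h s h0 h1 h2).ge)

theorem sizesExpect_add (α γ : ℝ) (k : ℕ) (F F' : List ℕ → ℝ≥0∞) :
    sizesExpect α γ k (fun s => F s + F' s) = sizesExpect α γ k F + sizesExpect α γ k F' := by
  induction k generalizing F F' with
  | zero => rfl
  | succ k ih =>
    have : sizesGenerator α γ k (fun s => F s + F' s) =
        fun s => sizesGenerator α γ k F s + sizesGenerator α γ k F' s := by
      funext s
      simp only [sizesGenerator, incr_add]
      ring
    simp only [sizesExpect, this, ih]
    ring

theorem sizesExpect_const_mul (α γ : ℝ) (k : ℕ) (c : ℝ≥0∞) (F : List ℕ → ℝ≥0∞) :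
    sizesExpect α γ k (fun s => c * F s) = c * sizesExpect α γ k F := by
  induction k generalizing F with
  | zero => rfl
  | succ k ih =>
    have : sizesGenerator α γ k (fun s => c * F s) = fun s => c * sizesGenerator α γ k F s := by
      funext s
      simp only [sizesGenerator, incr_const_mul]
      ring
    simp only [sizesExpect, this, ih]
    ring

theorem sizesExpect_zero (α γ : ℝ) (k : ℕ) : sizesExpect α γ k (fun _ => 0) = 0 := by
  simpa using sizesExpect_const_mul α γ k 0 fun _ => 0

theorem sizesExpect_ne_top {α γ : ℝ} (hα : α ≤ 1) {k : ℕ} {F : List ℕ → ℝ≥0∞}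
    (hF : ∀ s, F s ≠ ∞) : sizesExpect α γ k F ≠ ∞ := by
  induction k generalizing F with
  | zero => exact hF _
  | succ k ih =>
    have hk : 0 < (k : ℝ) + 2 - α := by have := k.cast_nonneg (α := ℝ); linarith
    refine ENNReal.mul_ne_top (by simpa using hk) (ENNReal.add_ne_top.2
      ⟨ENNReal.mul_ne_top ENNReal.ofReal_ne_top (hF _), ih fun s => ?_⟩)
    exact ENNReal.add_ne_top.2 ⟨ENNReal.mul_ne_top ENNReal.ofReal_ne_top (hF _),
      ENNReal.add_ne_top.2 ⟨incr_ne_top hF s, ENNReal.mul_ne_top ENNReal.ofReal_ne_top (hF _)⟩⟩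

/-- `B / M` is the fixed point for constant `b`. The deviation is multiplied at each step by a
factor at most `(k + 1 - α) / (k + 2 - α)`, whose products tend to zero, and an error `ε` in `b`
costs at most `ε` in the limit. -/
theorem tendsto_of_recurrence {α M B : ℝ} (hα : α ≤ 1) (hM : 1 ≤ M) {x b : ℕ → ℝ}
    (hx : ∀ᶠ k : ℕ in atTop, (k + 2 - α) * x (k + 1) = (k + 2 - M - α) * x k + b k)
    (hb : Tendsto b atTop (𝓝 B)) : Tendsto x atTop (𝓝 (B / M)) := by
  rw [Metric.tendsto_atTop]
  intro δ hδ
  obtain ⟨ε, hε, hεδ⟩ : ∃ ε, 0 < ε ∧ ε + ε < δ := ⟨δ / 3, by positivity, by linarith⟩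
  obtain ⟨K, hK⟩ := eventually_atTop.1 ((hx.and ((Metric.tendsto_nhds.1 hb) ε hε)).and
    (tendsto_natCast_atTop_atTop.eventually (eventually_ge_atTop (M + α))))
  -- Subtracting `ε` absorbs the error of `b k`: the two coefficients differ by `M`, and `M * ε ≥
  -- ε`.
  have hy : ∀ k ≥ K, (k + 2 - α) * (|x (k + 1) - B / M| - ε) ≤
      (k + 2 - M - α) * (|x k - B / M| - ε) := by
    intro k hk
    obtain ⟨⟨h1, h2⟩, h3⟩ := hK k hk
    rw [Real.dist_eq] at h2
    have e : (k + 2 - α) * (x (k + 1) - B / M) = (k + 2 - M - α) * (x k - B / M) + (b k - B) := by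
      rw [mul_sub, h1]; field_simp; ring
    have e2 := abs_add_le ((k + 2 - M - α) * (x k - B / M)) (b k - B)
    rw [← e, abs_mul, abs_mul, abs_of_nonneg (a := (k : ℝ) + 2 - α) (by linarith),
      abs_of_nonneg (a := (k : ℝ) + 2 - M - α) (by linarith)] at e2
    have e3 : 0 ≤ (M - 1) * ε := mul_nonneg (by linarith) hε.le
    linarith
  -- Since `M ≥ 1`, the quantity `(k + 1 - α) * (|x k - B / M| - ε)` cannot increase while it is
  -- positive; `C` bounds it from `K` on.
  set C := max 0 ((K + 1 - α) * (|x K - B / M| - ε)) with hC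
  have hz : ∀ k ≥ K, (k + 1 - α) * (|x k - B / M| - ε) ≤ C := by
    intro k hk
    induction k, hk using Nat.le_induction with
    | base => exact le_max_right _ _
    | succ k hk ih =>
      have h1 := hy k hk
      obtain ⟨-, h3⟩ := hK k hk
      push_cast
      rw [show (k : ℝ) + 1 + 1 - α = k + 2 - α by ring]
      refine h1.trans ?_
      rcases le_total 0 (|x k - B / M| - ε) with h | h
      · exact (mul_le_mul_of_nonneg_right (by linarith) h).trans ih
      · exact (mul_nonpos_of_nonneg_of_nonpos (by linarith) h).trans (le_max_left _ _)
  obtain ⟨K', hK'⟩ := eventually_atTop.1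
    (tendsto_natCast_atTop_atTop.eventually (eventually_ge_atTop (C / ε)))
  refine ⟨max K K', fun k hk => ?_⟩
  have h1 := hz k ((le_max_left _ _).trans hk)
  have h2 := hK' k ((le_max_right _ _).trans hk)
  obtain ⟨-, h3⟩ := hK k ((le_max_left _ _).trans hk)
  rw [div_le_iff₀ hε] at h2
  rw [Real.dist_eq]
  have h4 : |x k - B / M| - ε ≤ ε := by
    by_contra! h
    have h5 : ((k : ℝ) + 1 - α) * ε < (k + 1 - α) * (|x k - B / M| - ε) :=
      mul_lt_mul_of_pos_left h (by linarith)
    have h6 : 0 ≤ (1 - α) * ε := mul_nonneg (by linarith) hε.le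
    linarith
  linarith

/-- The sum of the sibling sizes only goes up by one or stays, except when the root edge is split,
which contributes the constant term `F [1]`. The generator is therefore triangular in the sum, which
allows the induction on `M`; finiteness of the limit is carried along to pass to real numbers. -/
theorem tendsto_sizesExpect_of_sum_eq {α γ : ℝ} (hγ : 0 < γ) (hγα : γ ≤ α) (hα : α ≤ 1) (M : ℕ)
    {F : List ℕ → ℝ≥0∞} (hF : PermInvariant F) (hF' : ∀ s, F s ≠ ∞)
    (hM : ∀ s, s.sum ≠ M → F s = 0) :
    expect (bushSizes α γ) F ≠ ∞ ∧
      Tendsto (fun k => sizesExpect α γ k F) atTop (𝓝 (expect (bushSizes α γ) F)) := by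
  induction M generalizing F with
  | zero =>
    rw [expect_bushSizes_eq_zero hM]
    refine ⟨ENNReal.zero_ne_top, tendsto_const_nhds.congr fun k => ?_⟩
    rw [← sizesExpect_zero α γ k]
    refine sizesExpect_congr fun s h0 h1 _ => (hM s fun hs => ?_).symm
    obtain ⟨l, hl⟩ := List.exists_mem_of_ne_nil s h0
    have := List.sum_eq_zero_iff.1 hs l hl
    have := h1 l hl
    omega
  | succ M ih =>
    -- The part of the generator that raises the sum by one; applied to a functional supported on
    -- sum `M + 1`, it is supported on sum `M`.
    set A : List ℕ → ℝ≥0∞ := fun s =>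
      incr α F s + ENNReal.ofReal (s.length * α - γ) * F (s ++ [1]) with hA
    have hAp : PermInvariant A := fun s s' h => by
      simp only [hA]
      rw [hF.incr s s' h, hF _ _ (h.append_right [1]), h.length_eq]
    have hAt : ∀ s, A s ≠ ∞ := fun s => ENNReal.add_ne_top.2
      ⟨incr_ne_top hF' s, ENNReal.mul_ne_top ENNReal.ofReal_ne_top (hF' _)⟩
    have hincr : ∀ {F : List ℕ → ℝ≥0∞} {M} s, (∀ s, s.sum ≠ M → F s = 0) → s.sum + 1 ≠ M →
        incr α F s = 0 := by
      intro F M s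
      induction s generalizing F M with
      | nil => simp [incr]
      | cons l s ih =>
        intro h hs
        simp only [List.sum_cons] at hs
        rw [incr, h _ (by simp; omega), mul_zero, zero_add]
        rcases lt_or_ge M l with hl | hl
        -- Here `F` vanishes at every list with head `l > M`, so any target sum other than `s.sum +
        -- 1` serves; this avoids the truncated subtraction `M - l`.
        · exact ih (M := s.sum) (fun s' _ => h _ (by simp; omega)) (by omega)
        · exact ih (M := M - l) (fun s' hs' => h _ (by simp; omega)) (by omega)
    have hAM : ∀ s, s.sum ≠ M → A s = 0 := fun s hs => by
      simp only [hA]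
      rw [hincr s hM (by omega), hM _ (by simp; omega), mul_zero, add_zero]
    obtain ⟨hfin, hlim⟩ := ih hAp hAt hAM
    -- On the support of `F` the factor `s.sum` is the constant `M + 1`, so the balance equation
    -- identifies the limit `B / (M + 1)` of the recurrence.
    have hst : ENNReal.ofReal γ * F [1] + expect (bushSizes α γ) A =
        (M + 1 : ℕ) * expect (bushSizes α γ) F := by
      rw [hA, expect_bushSizes_stationary hγ hγα hα hF, ← expect_const_mul]
      refine expect_congr _ fun s _ => ?_
      by_cases hs : s.sum = M + 1
      · rw [hs]
      · rw [hM s hs, mul_zero, mul_zero]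
    have hγF : ENNReal.ofReal γ * F [1] ≠ ∞ := ENNReal.mul_ne_top ENNReal.ofReal_ne_top (hF' _)
    have hFfin : expect (bushSizes α γ) F ≠ ∞ := by
      intro h
      rw [h, ENNReal.mul_top (by simp)] at hst
      exact ENNReal.add_ne_top.2 ⟨hγF, hfin⟩ hst
    refine ⟨hFfin, ?_⟩
    rw [← ENNReal.tendsto_toReal_iff (fun k => sizesExpect_ne_top hα hF') hFfin]
    have hlim' := tendsto_const_nhds (x := ENNReal.ofReal γ * F [1]) |>.add hlim
    rw [hst, ← ENNReal.tendsto_toReal_iff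
      (fun k => ENNReal.add_ne_top.2 ⟨hγF, sizesExpect_ne_top hα hAt⟩)
      (ENNReal.mul_ne_top (by simp) hFfin)] at hlim'
    have hM1 : (1 : ℝ) ≤ (M + 1 : ℕ) := by simp
    convert tendsto_of_recurrence hα hM1 ?_ hlim' using 2
    · rw [ENNReal.toReal_mul, ENNReal.toReal_natCast]
      field_simp
    · filter_upwards [eventually_ge_atTop (M + 1)] with k hk
      have hk' : ((M + 1 : ℕ) : ℝ) ≤ k := Nat.cast_le.2 hk
      have hgen : sizesExpect α γ k (sizesGenerator α γ k F) =
          ENNReal.ofReal (k + 2 - (M + 1 : ℕ) - α) * sizesExpect α γ k F + sizesExpect α γ k A := by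
        rw [← sizesExpect_const_mul, ← sizesExpect_add]
        congr 1
        funext s
        rw [sizesGenerator]
        congr 1
        by_cases hs : s.sum = M + 1
        · rw [hs]
        · rw [hM s hs, mul_zero, mul_zero]
      have hpos : 0 < (k : ℝ) + 2 - α := by linarith
      have h1 : ENNReal.ofReal (k + 2 - α) * sizesExpect α γ (k + 1) F =
          ENNReal.ofReal (k + 2 - (M + 1 : ℕ) - α) * sizesExpect α γ k F +
            (ENNReal.ofReal γ * F [1] + sizesExpect α γ k A) := by
        rw [sizesExpect, ← mul_assoc, ENNReal.mul_inv_cancel (by simpa using hpos)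
          ENNReal.ofReal_ne_top, one_mul, hgen]
        ring
      have h2 := congrArg ENNReal.toReal h1
      rwa [ENNReal.toReal_add (ENNReal.mul_ne_top ENNReal.ofReal_ne_top
        (sizesExpect_ne_top hα hF')) (ENNReal.add_ne_top.2 ⟨hγF, sizesExpect_ne_top hα hAt⟩),
        ENNReal.toReal_mul, ENNReal.toReal_mul, ENNReal.toReal_ofReal hpos.le,
        ENNReal.toReal_ofReal (by linarith)] at h2

/-- The functionals truncated to lists of sum less than `K` are finite combinations of the preceding
case, so they converge; they increase to `F`, which yields a bound of Fatou type. -/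
theorem expect_bushSizes_le_liminf {α γ : ℝ} (hγ : 0 < γ) (hγα : γ ≤ α) (hα : α ≤ 1)
    {F : List ℕ → ℝ≥0∞} (hF : PermInvariant F) (hF' : ∀ s, F s ≠ ∞) :
    expect (bushSizes α γ) F ≤ liminf (fun k => sizesExpect α γ k F) atTop := by
  set H : ℕ → List ℕ → ℝ≥0∞ := fun K s => if s.sum < K then F s else 0 with hH
  have hlim : ∀ K, Tendsto (fun k => sizesExpect α γ k (H K)) atTop
      (𝓝 (expect (bushSizes α γ) (H K))) := by
    intro K
    induction K with
    | zero => simp [hH, sizesExpect_zero, expect_const]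
    | succ K ih =>
      have : H (K + 1) = fun s => H K s + if s.sum = K then F s else 0 := by
        funext s
        simp only [hH]
        split_ifs <;> first | omega | simp
      simp only [this, sizesExpect_add, expect_add]
      refine ih.add (tendsto_sizesExpect_of_sum_eq hγ hγα hα K ?_ ?_ ?_).2
      · intro s s' h
        simp only [hF s s' h, h.sum_eq]
      · intro s
        split_ifs
        · exact hF' s
        · exact ENNReal.zero_ne_top
      · exact fun s hs => if_neg hs
  have hmono : Monotone H := fun K K' hKK' s => by
    simp only [hH]
    split_ifs <;> first | omega | simp
  have hsup : F = fun s => ⨆ K, H K s := by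
    funext s
    refine le_antisymm (le_iSup_of_le (s.sum + 1) (by simp [hH])) (iSup_le fun K => ?_)
    simp only [hH]
    split_ifs <;> simp
  conv_lhs => rw [hsup]
  rw [expect_iSup _ hmono]
  refine iSup_le fun K => ?_
  rw [← (hlim K).liminf_eq]
  refine liminf_le_liminf (Eventually.of_forall fun k => sizesExpect_mono fun s _ _ _ => ?_)
  simp only [hH]
  split_ifs <;> simp

/-! ### Trees with given subtrees above the root -/

namespace PlaneTree

/-- The tree such that the subtrees above the children of the root are listed. -/
def join (ts : List PlaneTree) : PlaneTree where
  carrier := {v | ∀ i w, v = i :: w → ∃ t, ts[i]? = some t ∧ w ∈ t.carrier}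
  root_mem := by simp
  parent_mem v j h := by
    rintro i w rfl
    obtain ⟨t, ht, hw⟩ := h i (w ++ [j]) rfl
    exact ⟨t, ht, t.parent_mem w j hw⟩
  children v hv := by
    rcases v with _ | ⟨i, w⟩
    · refine ⟨ts.length, fun i => ⟨fun h => ?_, fun h => ?_⟩⟩
      · obtain ⟨t, ht, -⟩ := h i [] rfl
        exact (List.getElem?_eq_some_iff.1 ht).1
      · rintro j w hj
        obtain ⟨rfl, rfl⟩ := List.cons.inj hj
        exact ⟨ts[i], List.getElem?_eq_getElem h, root_mem _⟩
    · obtain ⟨t, ht, hw⟩ := hv i w rfl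
      obtain ⟨c, hc⟩ := t.children w hw
      refine ⟨c, fun j => ?_⟩
      rw [← hc]
      constructor
      · intro h
        obtain ⟨t', ht', hw'⟩ := h i (w ++ [j]) rfl
        rw [ht] at ht'
        exact Option.some.inj ht' ▸ hw'
      · rintro h i' w' e
        obtain ⟨rfl, rfl⟩ := List.cons.inj e
        exact ⟨t, ht, h⟩

theorem nil_mem_carrier (t : PlaneTree) : [] ∈ t.carrier := t.root_mem

theorem cons_mem_join {ts : List PlaneTree} {i : ℕ} {w : List ℕ} :
    i :: w ∈ (join ts).carrier ↔ ∃ t, ts[i]? = some t ∧ w ∈ t.carrier := by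
  refine ⟨fun h => h i w rfl, fun h i' w' e => ?_⟩
  obtain ⟨rfl, rfl⟩ := List.cons.inj e
  exact h

theorem eq_join {t : PlaneTree} {ts : List PlaneTree}
    (h : ∀ i w, i :: w ∈ t.carrier ↔ ∃ t, ts[i]? = some t ∧ w ∈ t.carrier) : t = join ts := by
  ext v
  rcases v with _ | ⟨i, w⟩
  · exact ⟨fun _ => nil_mem_carrier _, fun _ => nil_mem_carrier _⟩
  · rw [h, cons_mem_join]

theorem numChildren_join_nil (ts : List PlaneTree) : (join ts).numChildren [] = ts.length := by
  have : {i : ℕ | [] ++ [i] ∈ (join ts).carrier} = (Finset.range ts.length : Set ℕ) := by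
    ext i
    simp only [List.nil_append, Set.mem_ofPred_eq, cons_mem_join, Finset.coe_range, Set.mem_Iio]
    constructor
    · rintro ⟨t, ht, -⟩
      exact (List.getElem?_eq_some_iff.1 ht).1
    · exact fun h => ⟨ts[i], List.getElem?_eq_getElem h, root_mem _⟩
  rw [numChildren, this, Set.ncard_coe_finset, Finset.card_range]

theorem numChildren_join_cons {ts : List PlaneTree} {i : ℕ} {t : PlaneTree} (ht : ts[i]? = some t)
    (w : List ℕ) : (join ts).numChildren (i :: w) = t.numChildren w := by
  rw [numChildren, numChildren]
  congr 1
  ext j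
  simp [cons_mem_join, ht]

theorem mem_single {v : List ℕ} : v ∈ single.carrier ↔ v = [] := Iff.rfl

theorem splitEdge_root (t : PlaneTree) : t.splitEdge t.root = join [t, single] := by
  refine eq_join fun i w => ?_
  simp only [splitEdge, root, Set.mem_ofPred_eq]
  rcases i with _ | _ | i <;> simp [mem_single]

theorem attachLeaf_join_root (ts : List PlaneTree) :
    (join ts).attachLeaf (join ts).root = join (ts ++ [single]) := by
  refine eq_join fun i w => ?_
  simp only [attachLeaf, root, Set.mem_ofPred_eq, cons_mem_join, numChildren_join_nil]
  rcases lt_trichotomy i ts.length with h | rfl | h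
  · rw [List.getElem?_append_left h]
    simp
    omega
  · simp [mem_single]
  · rw [List.getElem?_eq_none h.le, List.getElem?_eq_none (by simp; omega)]
    simp
    omega

theorem splitEdge_join_cons {ts : List PlaneTree} {i : ℕ} {t : PlaneTree} (ht : ts[i]? = some t)
    {w : List ℕ} (hw : w ∈ t.carrier) (h : i :: w ∈ (join ts).carrier) :
    (join ts).splitEdge ⟨i :: w, h⟩ = join (ts.set i (t.splitEdge ⟨w, hw⟩)) := by
  refine eq_join fun j v => ?_
  simp only [splitEdge, Set.mem_ofPred_eq, cons_mem_join, List.cons_append, List.cons.injEq,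
    List.cons_prefix_cons]
  by_cases hij : i = j
  · subst hij
    have hi : i < ts.length := (List.getElem?_eq_some_iff.1 ht).1
    simp [ht, List.getElem?_set_self hi]
  · rw [List.getElem?_set_ne hij]
    simp [hij, Ne.symm hij]

theorem attachLeaf_join_cons {ts : List PlaneTree} {i : ℕ} {t : PlaneTree} (ht : ts[i]? = some t)
    {w : List ℕ} (hw : w ∈ t.carrier) (h : i :: w ∈ (join ts).carrier) :
    (join ts).attachLeaf ⟨i :: w, h⟩ = join (ts.set i (t.attachLeaf ⟨w, hw⟩)) := by
  refine eq_join fun j v => ?_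
  simp only [attachLeaf, Set.mem_ofPred_eq, cons_mem_join, List.cons_append, List.cons.injEq,
    numChildren_join_cons ht]
  by_cases hij : i = j
  · subst hij
    have hi : i < ts.length := (List.getElem?_eq_some_iff.1 ht).1
    simp [ht, List.getElem?_set_self hi]
  · rw [List.getElem?_set_ne hij]
    simp [Ne.symm hij]

theorem cherry_eq_join : cherry = join [single, single] := by
  refine eq_join fun i w => ?_
  simp only [cherry]
  rcases i with _ | _ | i <;> simp [mem_single]

theorem spineTree_eq_join (x : ℕ → ℕ) (τ : ℕ → ℕ → PlaneTree) :
    spineTree x τ = join (spineTree (fun n => x (n + 1)) (fun n => τ (n + 1)) ::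
      (List.range (x 0 + 1)).map (τ 0)) := by
  refine eq_join fun i w => ?_
  rcases i with _ | i
  · simp only [List.getElem?_cons_zero, Option.some.injEq, exists_eq_left', spineTree,
      Set.mem_ofPred_eq]
    refine or_congr ⟨?_, ?_⟩ ⟨?_, ?_⟩
    · rintro ⟨_ | n, h⟩
      · simp at h
      · exact ⟨n, (List.cons.inj h).2⟩
    · rintro ⟨n, rfl⟩
      exact ⟨n + 1, rfl⟩
    · rintro ⟨_ | n, j, u, hj, hu, h⟩
      · simp at h
      · exact ⟨n, j, u, hj, hu, (List.cons.inj h).2⟩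
    · rintro ⟨n, j, u, hj, hu, rfl⟩
      exact ⟨n + 1, j, u, hj, hu, rfl⟩
  · simp only [List.getElem?_cons_succ, List.getElem?_map, Option.map_eq_some_iff, spineTree,
      Set.mem_ofPred_eq, List.getElem?_eq_some_iff, List.length_range, List.getElem_range]
    constructor
    · rintro (⟨_ | n, h⟩ | ⟨_ | n, j, u, hj, hu, h⟩)
      · simp at h
      · simp [List.replicate_succ] at h
      · simp only [List.replicate_zero, List.nil_append, List.cons.injEq, Nat.add_right_cancel_iff] at h
        obtain ⟨rfl, rfl⟩ := h
        exact ⟨_, ⟨i, ⟨by omega, rfl⟩, rfl⟩, hu⟩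
      · simp [List.replicate_succ] at h
    · rintro ⟨_, ⟨j, ⟨hj, rfl⟩, rfl⟩, hw⟩
      exact Or.inr ⟨0, i, w, by omega, hw, rfl⟩

/-! ### Balls and equivalences of joined trees -/

theorem ball_join (R : ℕ) (ts : List PlaneTree) :
    ball (R + 1) (join ts) = join (ts.map (ball R)) := by
  refine eq_join fun i w => ?_
  simp only [ball, Set.mem_ofPred_eq, cons_mem_join, List.getElem?_map, Option.map_eq_some_iff,
    List.length_cons, Nat.add_le_add_iff_right]
  constructor
  · rintro ⟨⟨t, ht, hw⟩, hl⟩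
    exact ⟨_, ⟨t, ht, rfl⟩, hw, hl⟩
  · rintro ⟨_, ⟨t, ht, rfl⟩, hw, hl⟩
    exact ⟨⟨t, ht, hw⟩, hl⟩

/-- The vertices of `join ts` are the root and the vertices of the trees in `ts`. -/
noncomputable def joinEquiv (ts : List PlaneTree) :
    Option (Σ i : Fin ts.length, (ts.get i).carrier) ≃ (join ts).carrier :=
  Equiv.ofBijective
    (fun o => o.elim (join ts).root fun p => ⟨p.1.1 :: p.2.1,
      cons_mem_join.2 ⟨_, List.getElem?_eq_getElem p.1.2, p.2.2⟩⟩) <| by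
    constructor
    · rintro (_ | ⟨⟨i, hi⟩, w, hw⟩) (_ | ⟨⟨j, hj⟩, v, hv⟩) h
      · rfl
      · exact absurd (congrArg Subtype.val h) (by simp [root])
      · exact absurd (congrArg Subtype.val h) (by simp [root])
      · have := congrArg Subtype.val h
        simp only [Option.elim_some, List.cons.injEq] at this
        obtain ⟨rfl, rfl⟩ := this
        rfl
    · rintro ⟨_ | ⟨i, w⟩, h⟩
      · exact ⟨none, rfl⟩
      · obtain ⟨t, ht, hw⟩ := cons_mem_join.1 h
        obtain ⟨hi, rfl⟩ := List.getElem?_eq_some_iff.1 ht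
        exact ⟨some ⟨⟨i, hi⟩, w, hw⟩, rfl⟩

theorem joinEquiv_none (ts : List PlaneTree) : joinEquiv ts none = (join ts).root := rfl

open Classical in
theorem parent_joinEquiv_some (ts : List PlaneTree) (i : Fin ts.length) (w : (ts.get i).carrier) :
    (join ts).parent (joinEquiv ts (some ⟨i, w⟩)) = if w = (ts.get i).root then (join ts).root
      else joinEquiv ts (some ⟨i, (ts.get i).parent w⟩) := by
  split_ifs with h
  · subst h
    rfl
  · refine Subtype.ext ?_
    obtain ⟨_ | ⟨a, w⟩, hw⟩ := w
    · exact absurd rfl h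
    · rfl

/-- The permutation `e` of the subtrees and the bijections inside them glue together with the root
fixed; a vertex is a child of the root exactly when it is the root of its subtree, which the `σ i`
preserve. -/
theorem Equivalent.join {ts ts' : List PlaneTree} (e : Fin ts.length ≃ Fin ts'.length)
    (h : ∀ i, Equivalent (ts.get i) (ts'.get (e i))) : Equivalent (join ts) (join ts') := by
  classical
  choose σ h0 h1 using h
  let Φ := ((joinEquiv ts).symm.trans (Equiv.optionCongr (Equiv.sigmaCongr e σ))).trans
    (joinEquiv ts')
  have hΦ0 : Φ (PlaneTree.join ts).root = (PlaneTree.join ts').root := by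
    simp [Φ, ← joinEquiv_none]
  have hΦ : ∀ i w, Φ (joinEquiv ts (some ⟨i, w⟩)) = joinEquiv ts' (some ⟨e i, σ i w⟩) := by
    intro i w
    simp only [Φ, Equiv.trans_apply, Equiv.symm_apply_apply, Equiv.optionCongr_apply,
      Option.map_some]
    rfl
  refine ⟨Φ, hΦ0, fun u hu => ?_⟩
  obtain ⟨_ | ⟨i, w⟩, rfl⟩ := (joinEquiv ts).surjective u
  · exact absurd (joinEquiv_none ts) hu
  · rw [hΦ, parent_joinEquiv_some, parent_joinEquiv_some]
    by_cases hw : w = (ts.get i).root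
    · rw [if_pos hw, if_pos (by rw [hw, h0]), hΦ0]
    · rw [if_neg hw, if_neg (by rw [← h0]; exact fun h => hw ((σ i).injective h)), hΦ, h1 i w hw]

theorem Equivalent.join_cons {t t' : PlaneTree} (h : Equivalent t t') (ts : List PlaneTree) :
    Equivalent (PlaneTree.join (t :: ts)) (PlaneTree.join (t' :: ts)) := by
  refine Equivalent.join (Equiv.refl (Fin (ts.length + 1))) fun i => ?_
  refine Fin.cases ?_ (fun j => ?_) i
  · exact h
  · exact Equivalent.refl _

theorem exists_equiv_of_perm {ts ts' : List PlaneTree} (h : ts.Perm ts') :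
    ∃ e : Fin ts.length ≃ Fin ts'.length, ∀ i, ts.get i = ts'.get (e i) := by
  induction h with
  | nil => exact ⟨Equiv.refl _, fun i => i.elim0⟩
  | cons t _ ih =>
    obtain ⟨e, he⟩ := ih
    refine ⟨(finSuccEquiv _).trans ((Equiv.optionCongr e).trans (finSuccEquiv _).symm),
      fun i => ?_⟩
    refine Fin.cases ?_ (fun j => ?_) i
    · simp
    · simpa using he j
  | swap t t' ts =>
    refine ⟨Equiv.swap (0 : Fin (ts.length + 2)) 1, fun i => ?_⟩
    refine Fin.cases ?_ (fun j => Fin.cases ?_ (fun j => ?_) j) i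
    · simp
    · have : (Fin.succ 0 : Fin (ts.length + 2)) = 1 := rfl
      rw [this, Equiv.swap_apply_right]
      rfl
    · have : Equiv.swap (0 : Fin (ts.length + 2)) 1 j.succ.succ = j.succ.succ :=
        Equiv.swap_apply_of_ne_of_ne (Fin.succ_ne_zero _)
          (fun h => Fin.succ_ne_zero j (Fin.succ_injective _ h))
      exact (congrArg (t :: t' :: ts).get this).symm
  | trans _ _ h1 h2 =>
    obtain ⟨e, he⟩ := h1
    obtain ⟨e', he'⟩ := h2
    exact ⟨e.trans e', fun i => (he i).trans (he' _)⟩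

theorem shape_join_perm {ts ts' : List PlaneTree} (h : ts.Perm ts') :
    (join ts).shape = (join ts').shape := by
  obtain ⟨e, he⟩ := exists_equiv_of_perm h
  exact Quotient.sound (Equivalent.join e fun i => by rw [he i]; exact Equivalent.refl _)

end PlaneTree

/-- The tree such that the subtrees above the children of the root are listed, in terms of the
shape of the first of these subtrees. -/
def Tree.graft (ts : List PlaneTree) : Tree → Tree :=
  Quotient.map (fun t => PlaneTree.join (t :: ts)) fun _ _ h => PlaneTree.Equivalent.join_cons h ts

theorem Tree.graft_shape (ts : List PlaneTree) (t : PlaneTree) :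
    Tree.graft ts t.shape = (PlaneTree.join (t :: ts)).shape := rfl

/-- This is what lowers the radius by one in the final induction. -/
theorem Tree.ball_graft (R : ℕ) (ts : List PlaneTree) {t s : Tree} (h : ball R t = ball R s) :
    ball (R + 1) (graft ts t) = ball (R + 1) (graft ts s) := by
  induction t using Quotient.inductionOn with
  | h t =>
  induction s using Quotient.inductionOn with
  | h s =>
    have h' : PlaneTree.Equivalent (PlaneTree.ball R t) (PlaneTree.ball R s) := Quotient.exact h
    have := h'.join_cons (ts.map (PlaneTree.ball R))
    rw [← List.map_cons, ← List.map_cons, ← PlaneTree.ball_join, ← PlaneTree.ball_join] at this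
    exact Quotient.sound this

/-! ### Growth of a tree in terms of its subtrees above the root -/

namespace FinPlaneTree

theorem tree_injective : Function.Injective tree := fun t s h => by
  cases t; cases s; cases h; rfl

/-- The finite tree such that the subtrees above the children of the root are listed. -/
noncomputable def join (ts : List FinPlaneTree) : FinPlaneTree :=
  ⟨PlaneTree.join (ts.map tree), by
    have : ∀ i, Finite ((ts.map tree).get i).carrier := fun i => by
      obtain ⟨t, -, ht⟩ := List.mem_map.1 (List.get_mem (ts.map tree) i)
      rw [← ht]
      exact t.finite
    have := Finite.of_equiv _ (PlaneTree.joinEquiv (ts.map tree))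
    exact Set.toFinite _⟩

theorem tree_join (ts : List FinPlaneTree) : (join ts).tree = PlaneTree.join (ts.map tree) := rfl

theorem splitEdge_root (t : FinPlaneTree) : t.splitEdge t.tree.root = join [t, single] :=
  tree_injective (PlaneTree.splitEdge_root t.tree)

theorem attachLeaf_join_root (ts : List FinPlaneTree) :
    (join ts).attachLeaf (join ts).tree.root = join (ts ++ [single]) :=
  tree_injective <| (PlaneTree.attachLeaf_join_root (ts.map tree)).trans <| by
    rw [tree_join, List.map_append]
    rfl

theorem splitEdge_join_cons {ts : List FinPlaneTree} {i : ℕ} {t : FinPlaneTree}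
    (ht : ts[i]? = some t) {w : List ℕ} (hw : w ∈ t.tree.carrier)
    (h : i :: w ∈ (join ts).tree.carrier) :
    (join ts).splitEdge ⟨i :: w, h⟩ = join (ts.set i (t.splitEdge ⟨w, hw⟩)) :=
  tree_injective <| (PlaneTree.splitEdge_join_cons (by simp [ht]) hw h).trans <| by
    rw [tree_join, List.map_set]
    rfl

theorem attachLeaf_join_cons {ts : List FinPlaneTree} {i : ℕ} {t : FinPlaneTree}
    (ht : ts[i]? = some t) {w : List ℕ} (hw : w ∈ t.tree.carrier)
    (h : i :: w ∈ (join ts).tree.carrier) :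
    (join ts).attachLeaf ⟨i :: w, h⟩ = join (ts.set i (t.attachLeaf ⟨w, hw⟩)) :=
  tree_injective <| (PlaneTree.attachLeaf_join_cons (by simp [ht]) hw h).trans <| by
    rw [tree_join, List.map_set]
    rfl

theorem cherry_eq_join : cherry = join [single, single] :=
  tree_injective PlaneTree.cherry_eq_join

theorem cons_mem_join {ts : List FinPlaneTree} {i : ℕ} {w : List ℕ} :
    i :: w ∈ (join ts).tree.carrier ↔ ∃ t, ts[i]? = some t ∧ w ∈ t.tree.carrier := by
  rw [join, PlaneTree.cons_mem_join]
  simp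

theorem numChildren_join_nil (ts : List FinPlaneTree) :
    (join ts).tree.numChildren [] = ts.length := by
  rw [join, PlaneTree.numChildren_join_nil, List.length_map]

theorem numChildren_join_cons {ts : List FinPlaneTree} {i : ℕ} {t : FinPlaneTree}
    (ht : ts[i]? = some t) (w : List ℕ) :
    (join ts).tree.numChildren (i :: w) = t.tree.numChildren w :=
  PlaneTree.numChildren_join_cons (by simp [ht]) w

end FinPlaneTree

open FinPlaneTree

/-- The sum over the places of `t` of their weights times the values of `f` at the trees that are
obtained by growing `t` at these places. -/
noncomputable def growSum (α γ : ℝ) (t : FinPlaneTree) (f : FinPlaneTree → ℝ≥0∞) : ℝ≥0∞ :=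
  ∑' p : Place t, ENNReal.ofReal (weight α γ t p) * f (grow t p)

open Classical in
/-- The terms of `growSum` that correspond to the edge and the vertex at the word `v`. -/
noncomputable def growTerm (α γ : ℝ) (t : FinPlaneTree) (f : FinPlaneTree → ℝ≥0∞) (v : List ℕ) :
    ℝ≥0∞ :=
  if h : v ∈ t.tree.carrier then
    ENNReal.ofReal (weight α γ t (Sum.inl ⟨v, h⟩)) * f (t.splitEdge ⟨v, h⟩) +
      ENNReal.ofReal (weight α γ t (Sum.inr ⟨v, h⟩)) * f (t.attachLeaf ⟨v, h⟩)
  else 0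

/-- Summing over all words, with zero terms outside the tree, allows a decomposition by the first
letter without transporting places between types. -/
theorem growSum_eq_tsum (α γ : ℝ) (t : FinPlaneTree) (f : FinPlaneTree → ℝ≥0∞) :
    growSum α γ t f = ∑' v, growTerm α γ t f v := by
  have : Function.support (growTerm α γ t f) ⊆ t.tree.carrier := fun v hv => by
    by_contra h
    exact hv (dif_neg h)
  rw [← tsum_subtype_eq_of_support_subset this, growSum,
    Summable.tsum_sum ENNReal.summable ENNReal.summable, ← ENNReal.tsum_add]
  refine tsum_congr fun v => ?_
  rw [growTerm, dif_pos v.2]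
  rfl

theorem tsum_list (h : List ℕ → ℝ≥0∞) : ∑' v, h v = h [] + ∑' (i : ℕ) (w : List ℕ), h (i :: w) := by
  let g : List ℕ → ℝ≥0∞ := fun v => if v.isEmpty then 0 else h v
  have hinj : Function.Injective fun p : ℕ × List ℕ => p.1 :: p.2 := by
    rintro ⟨i, w⟩ ⟨j, v⟩ e
    simpa using e
  have h1 : ∑' v, h v = h [] + ∑' v, g v := by
    rw [ENNReal.tsum_eq_add_tsum_ite (f := h) []]
    congr 1
    refine tsum_congr fun v => ?_
    simp [g]
  have h2 : ∑' p : ℕ × List ℕ, g (p.1 :: p.2) = ∑' v, g v := by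
    refine hinj.tsum_eq (f := g) fun v hv => ?_
    rcases v with _ | ⟨i, w⟩
    · simp [g] at hv
    · exact ⟨(i, w), rfl⟩
  rw [h1, ← h2, ENNReal.tsum_prod (f := fun i w => g (i :: w))]
  simp [g]

/-- The sum over the trees of a list of the values of `growSum` when this tree grows. -/
noncomputable def growSumList (α γ : ℝ) :
    (List FinPlaneTree → ℝ≥0∞) → List FinPlaneTree → ℝ≥0∞
  | _, [] => 0
  | f, t :: ts => growSum α γ t (fun t' => f (t' :: ts)) + growSumList α γ (fun s => f (t :: s)) ts

theorem growSumList_eq_tsum (α γ : ℝ) (f : List FinPlaneTree → ℝ≥0∞) (ts : List FinPlaneTree) :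
    growSumList α γ f ts =
      ∑' i : ℕ, (ts[i]?).elim 0 fun t => growSum α γ t fun t' => f (ts.set i t') := by
  induction ts generalizing f with
  | nil => simp [growSumList]
  | cons t ts ih =>
    rw [tsum_eq_zero_add' ENNReal.summable, growSumList, ih]
    rfl

/-- The empty word carries the phantom edge and the root vertex; a word with first letter `i`
carries the places of the `i`-th subtree, where the weights agree because the numbers of children
do. -/
theorem growSum_join (α γ : ℝ) {ts : List FinPlaneTree} (hts : ts ≠ [])
    (f : FinPlaneTree → ℝ≥0∞) :
    growSum α γ (join ts) f = ENNReal.ofReal γ * f (join [join ts, single]) +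
      (ENNReal.ofReal ((ts.length - 1) * α - γ) * f (join (ts ++ [single])) +
        growSumList α γ (fun s => f (join s)) ts) := by
  rw [growSum_eq_tsum, tsum_list, ← add_assoc, growSumList_eq_tsum]
  congr 1
  · have h0 : (join ts).tree.numChildren [] ≠ 0 := by
      rw [numChildren_join_nil]
      simpa using hts
    rw [growTerm, dif_pos (join ts).tree.root_mem, weight, weight, if_neg h0, if_neg h0,
      numChildren_join_nil, ← splitEdge_root, ← attachLeaf_join_root]
    rfl
  · refine tsum_congr fun i => ?_
    rcases ht : ts[i]? with _ | t
    · have : ∀ w, growTerm α γ (join ts) f (i :: w) = 0 := fun w => by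
        rw [growTerm, dif_neg]
        rw [cons_mem_join, ht]
        simp
      simp [this]
    · rw [Option.elim_some, growSum_eq_tsum]
      refine tsum_congr fun w => ?_
      by_cases hw : w ∈ t.tree.carrier
      · have h : i :: w ∈ (join ts).tree.carrier := cons_mem_join.2 ⟨t, ht, hw⟩
        rw [growTerm, growTerm, dif_pos h, dif_pos hw, splitEdge_join_cons ht hw,
          attachLeaf_join_cons ht hw]
        simp only [weight, numChildren_join_cons ht]
      · rw [growTerm, growTerm, dif_neg hw, dif_neg]
        rw [cons_mem_join, ht]
        simpa using hw

theorem growSum_single (α γ : ℝ) (f : FinPlaneTree → ℝ≥0∞) :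
    growSum α γ single f = ENNReal.ofReal (1 - α) * f cherry := by
  have h0 : single.tree.numChildren [] = 0 := by
    have : {i : ℕ | [] ++ [i] ∈ single.tree.carrier} = ∅ := by
      ext i
      simp [single, PlaneTree.single]
    rw [PlaneTree.numChildren, this, Set.ncard_empty]
  rw [growSum_eq_tsum, tsum_eq_single []]
  · rw [growTerm, dif_pos single.tree.root_mem, weight, weight, if_pos h0, if_pos h0,
      ENNReal.ofReal_zero, zero_mul, add_zero, cherry_eq_join, ← splitEdge_root]
    rfl
  · intro v hv
    exact dif_neg hv

/-- Stated as a product to avoid dividing by the total weight; in the degenerate case both sides are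
zero. -/
theorem growSum_one_mul_expect (α γ : ℝ) (t : FinPlaneTree) (f : FinPlaneTree → ℝ≥0∞) :
    growSum α γ t (fun _ => 1) * expect (growStep α γ t) f = growSum α γ t f := by
  have h1 : growSum α γ t (fun _ => 1) = ∑' p : Place t, ENNReal.ofReal (weight α γ t p) := by
    simp [growSum]
  by_cases h : ∑' p : Place t, ENNReal.ofReal (weight α γ t p) = 0
  · rw [h1, h, zero_mul, growSum]
    rw [ENNReal.tsum_eq_zero] at h
    simp [h]
  · have htop : ∑' p : Place t, ENNReal.ofReal (weight α γ t p) ≠ ∞ := by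
      have := Fintype.ofFinite (Place t)
      rw [tsum_fintype]
      exact (ENNReal.sum_lt_top.2 fun _ _ => ENNReal.ofReal_lt_top).ne
    rw [h1, growStep, dif_neg h, expect_map, expect, growSum, ← ENNReal.tsum_mul_left]
    refine tsum_congr fun p => ?_
    rw [PMF.normalize_apply, ← mul_assoc, mul_left_comm, ENNReal.mul_inv_cancel h htop, mul_one]

/-! ### The Markov branching property -/

/-- The expectation of a functional of independent growing trees with given numbers of leaves. -/
noncomputable def subtreesExpect (α γ : ℝ) (F : List FinPlaneTree → ℝ≥0∞) (L : List ℕ) : ℝ≥0∞ :=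
  expect (indepList (L.map (agPlane α γ))) F

theorem subtreesExpect_nil (α γ : ℝ) (F : List FinPlaneTree → ℝ≥0∞) :
    subtreesExpect α γ F [] = F [] := expect_indepList_nil F

theorem subtreesExpect_cons (α γ : ℝ) (F : List FinPlaneTree → ℝ≥0∞) (l : ℕ) (L : List ℕ) :
    subtreesExpect α γ F (l :: L) =
      expect (agPlane α γ l) fun t => subtreesExpect α γ (fun ts => F (t :: ts)) L :=
  expect_indepList_cons _ _ F

theorem subtreesExpect_concat_one (α γ : ℝ) (F : List FinPlaneTree → ℝ≥0∞) (L : List ℕ) :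
    subtreesExpect α γ F (L ++ [1]) = subtreesExpect α γ (fun ts => F (ts ++ [single])) L := by
  rw [subtreesExpect, List.map_append]
  exact expect_indepList_concat_pure _ _ F

/-- The total weight of the places of a growing tree with `n` leaves is `n - α`. -/
def HasTotalWeight (α γ : ℝ) (n : ℕ) : Prop :=
  ∀ t ∈ (agPlane α γ n).support, growSum α γ t (fun _ => 1) = ENNReal.ofReal (n - α)

theorem hasTotalWeight_one (α γ : ℝ) : HasTotalWeight α γ 1 := by
  intro t ht
  have : t = single := by simpa [agPlane] using ht
  rw [this, growSum_single, mul_one, Nat.cast_one]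

/-- For `n = 1` the cherry is prescribed rather than grown, but the only place of positive weight on
a single vertex also produces the cherry; for `α = 1` both sides vanish. -/
theorem expect_agPlane_succ {α γ : ℝ} {n : ℕ} (hn : 1 ≤ n) (h : HasTotalWeight α γ n)
    (f : FinPlaneTree → ℝ≥0∞) :
    ENNReal.ofReal (n - α) * expect (agPlane α γ (n + 1)) f =
      expect (agPlane α γ n) fun t => growSum α γ t f := by
  rcases n with _ | _ | n
  · omega
  · simp only [zero_add, agPlane, expect_pure, growSum_single, Nat.cast_one]
  · rw [show agPlane α γ (n + 1 + 1 + 1) = (agPlane α γ (n + 2)).bind (growStep α γ) from rfl,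
      expect_bind, ← expect_const_mul]
    refine expect_congr _ fun t ht => ?_
    rw [← growSum_one_mul_expect, h t ht]

/-- Growing one tree in an independent family replaces its size `l` by `l + 1`, with the factor `l -
α`, and leaves the other laws unchanged. -/
theorem subtreesExpect_growSumList {α γ : ℝ} {L : List ℕ}
    (hL : ∀ l ∈ L, 1 ≤ l ∧ HasTotalWeight α γ l) (F : List FinPlaneTree → ℝ≥0∞) :
    subtreesExpect α γ (growSumList α γ F) L = incr α (subtreesExpect α γ F) L := by
  induction L generalizing F with
  | nil => simp [subtreesExpect_nil, growSumList, incr]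
  | cons l L ih =>
    simp only [List.mem_cons, forall_eq_or_imp] at hL
    have h1 : ∀ t, subtreesExpect α γ (fun ts => growSumList α γ F (t :: ts)) L =
        subtreesExpect α γ (fun ts => growSum α γ t fun t' => F (t' :: ts)) L +
          incr α (subtreesExpect α γ fun ts => F (t :: ts)) L := fun t => by
      rw [← ih hL.2]
      exact expect_add _ _ _
    have h2 : expect (agPlane α γ l)
        (fun t => subtreesExpect α γ (fun ts => growSum α γ t fun t' => F (t' :: ts)) L) =
        ENNReal.ofReal (l - α) * subtreesExpect α γ F ((l + 1) :: L) := by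
      rw [subtreesExpect_cons]
      simp only [subtreesExpect]
      rw [expect_comm, expect_comm (agPlane α γ (l + 1)), ← expect_const_mul]
      exact expect_congr _ fun ts _ => (expect_agPlane_succ hL.1.1 hL.1.2 _).symm
    rw [subtreesExpect_cons]
    simp only [h1]
    rw [expect_add, h2, ← incr_expect, incr]
    simp only [← subtreesExpect_cons]

theorem sum_ofReal_sub {α : ℝ} (hα : α ≤ 1) {L : List ℕ} (hL : ∀ l ∈ L, 1 ≤ l) :
    (L.map fun l : ℕ => ENNReal.ofReal (l - α)).sum = ENNReal.ofReal (L.sum - L.length * α) ∧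
      0 ≤ (L.sum : ℝ) - L.length * α := by
  induction L with
  | nil => simp
  | cons l L ih =>
    simp only [List.mem_cons, forall_eq_or_imp] at hL
    obtain ⟨ih1, ih2⟩ := ih hL.2
    have h1 : (1 : ℝ) ≤ l := by exact_mod_cast hL.1
    rw [List.map_cons, List.sum_cons, ih1, ← ENNReal.ofReal_add (by linarith) ih2]
    simp only [List.sum_cons, List.length_cons, Nat.cast_add, Nat.cast_one]
    constructor
    · congr 1
      ring
    · linarith

theorem growSumList_one {α γ : ℝ} {L : List ℕ} (hL : ∀ l ∈ L, HasTotalWeight α γ l)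
    {ts : List FinPlaneTree} (hts : ts ∈ (indepList (L.map (agPlane α γ))).support) :
    growSumList α γ (fun _ => 1) ts = (L.map fun l : ℕ => ENNReal.ofReal (l - α)).sum ∧
      ts.length = L.length := by
  induction L generalizing ts with
  | nil =>
    have : ts = [] := by simpa [indepList] using hts
    simp [this, growSumList]
  | cons l L ih =>
    simp only [List.mem_cons, forall_eq_or_imp] at hL
    rw [List.map_cons, indepList, PMF.mem_support_bind_iff] at hts
    obtain ⟨t, ht, hts⟩ := hts
    rw [PMF.mem_support_map_iff] at hts
    obtain ⟨s, hs, rfl⟩ := hts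
    rw [growSumList, hL.1 t ht, (ih hL.2 hs).1, List.length_cons, (ih hL.2 hs).2]
    exact ⟨rfl, rfl⟩

/-- The Markov branching property at a given number of leaves: conditionally on their numbers of
leaves, the subtrees above the root are independent growing trees. -/
def MarkovBranching (α γ : ℝ) (k : ℕ) : Prop :=
  ∀ f : FinPlaneTree → ℝ≥0∞, expect (agPlane α γ (k + 2)) f = sizesExpect α γ k fun s =>
    subtreesExpect α γ (fun ts => f (join ts)) ((k + 2 - s.sum) :: s)

/-- With subtree sizes `L`, the root edge has weight `γ`, the root vertex `(L.length - 1) * α - γ`,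
and the subtrees together `L.sum - L.length * α`; the total is `L.sum - α`. -/
theorem MarkovBranching.hasTotalWeight {α γ : ℝ} (hγ : 0 < γ) (hγα : γ ≤ α) (hα : α ≤ 1) {k : ℕ}
    (h : MarkovBranching α γ k) (hW : ∀ l, 1 ≤ l → l ≤ k + 1 → HasTotalWeight α γ l) :
    HasTotalWeight α γ (k + 2) := by
  classical
  -- The almost sure statement becomes a vanishing expectation, to which the branching identity
  -- applies.
  refine (mem_support_iff_expect _ fun t => growSum α γ t (fun _ => 1) =
    ENNReal.ofReal ((k + 2 : ℕ) - α)).1 ?_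
  rw [h]
  refine Eq.trans (sizesExpect_congr fun s h0 h1 h2 => ?_) (sizesExpect_zero α γ k)
  have hls : ∀ l ∈ s, l ≤ s.sum := fun l hl => List.le_sum_of_mem hl
  obtain ⟨l, hl⟩ := List.exists_mem_of_ne_nil s h0
  have hs1 : 1 ≤ s.sum := (h1 l hl).trans (hls l hl)
  have hL1 : ∀ l ∈ (k + 2 - s.sum) :: s, 1 ≤ l := by
    simp only [List.mem_cons, forall_eq_or_imp]
    exact ⟨by omega, h1⟩
  have hL : ∀ l ∈ (k + 2 - s.sum) :: s, HasTotalWeight α γ l := by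
    simp only [List.mem_cons, forall_eq_or_imp]
    exact ⟨hW _ (by omega) (by omega), fun l hl => hW l (h1 l hl) ((hls l hl).trans h2)⟩
  refine (mem_support_iff_expect _ fun ts => growSum α γ (join ts) (fun _ => 1) =
    ENNReal.ofReal ((k + 2 : ℕ) - α)).2 fun ts hts => ?_
  obtain ⟨hsum, hlen⟩ := growSumList_one hL hts
  have hne : ts ≠ [] := by
    rintro rfl
    simp at hlen
  have hlen0 : (1 : ℝ) ≤ s.length := by
    exact_mod_cast List.length_pos_iff.2 h0
  have hlenα : α ≤ s.length * α := le_mul_of_one_le_left (hγ.trans_le hγα).le hlen0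
  obtain ⟨e1, e2⟩ := sum_ofReal_sub hα hL1
  rw [growSum_join α γ hne, hsum, e1, hlen, mul_one, mul_one, List.length_cons, Nat.cast_add,
    Nat.cast_one, add_sub_cancel_right, List.sum_cons, Nat.sub_add_cancel (by omega),
    ← ENNReal.ofReal_add (by linarith), ← ENNReal.ofReal_add hγ.le]
  · congr 1
    push_cast
    ring
  all_goals
    rw [List.sum_cons, Nat.sub_add_cancel (by omega), List.length_cons] at e2
    push_cast at e2 ⊢
    linarith

/-- One growth step is conditioned on the sizes and expanded by `growSum_join`; its four kinds of
moves reproduce the recursion that defines `sizesExpect`. -/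
theorem MarkovBranching.succ {α γ : ℝ} (hα : α ≤ 1) {k : ℕ} (h : MarkovBranching α γ k)
    (hW : ∀ l, 1 ≤ l → l ≤ k + 2 → HasTotalWeight α γ l) : MarkovBranching α γ (k + 1) := by
  intro f
  have hpos : 0 < (k : ℝ) + 2 - α := by have := k.cast_nonneg (α := ℝ); linarith
  set J := subtreesExpect α γ fun ts => f (join ts) with hJ
  have h1 := expect_agPlane_succ (by omega) (hW (k + 2) (by omega) le_rfl) f
  rw [sizesExpect]
  have h2 : expect (agPlane α γ (k + 2)) (fun t => growSum α γ t f) =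
      ENNReal.ofReal γ * J [k + 2, 1] +
        sizesExpect α γ k (sizesGenerator α γ k fun s => J ((k + 1 + 2 - s.sum) :: s)) := by
    -- Splitting the phantom edge makes the old tree, with its `k + 2` leaves, the distinguished
    -- subtree; the branching identity is used backwards here.
    have hroot : J [k + 2, 1] = sizesExpect α γ k fun s =>
        subtreesExpect α γ (fun ts => f (join [join ts, single])) ((k + 2 - s.sum) :: s) := by
      rw [← h fun t => f (join [t, single]), hJ, subtreesExpect_cons]
      refine expect_congr _ fun t _ => ?_
      rw [← List.nil_append [1], subtreesExpect_concat_one, subtreesExpect_nil, List.nil_append]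
    rw [h, hroot, ← sizesExpect_const_mul, ← sizesExpect_add]
    refine sizesExpect_congr fun s hs0 hs1 hs2 => ?_
    have hls : ∀ l ∈ s, l ≤ s.sum := fun l hl => List.le_sum_of_mem hl
    obtain ⟨l, hl⟩ := List.exists_mem_of_ne_nil s hs0
    have hsum : 1 ≤ s.sum := (hs1 l hl).trans (hls l hl)
    have hL : ∀ l ∈ (k + 2 - s.sum) :: s, 1 ≤ l ∧ HasTotalWeight α γ l := by
      simp only [List.mem_cons, forall_eq_or_imp]
      exact ⟨⟨by omega, hW _ (by omega) (by omega)⟩,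
        fun l hl => ⟨hs1 l hl, hW l (hs1 l hl) (by have := hls l hl; omega)⟩⟩
    have hgrow : subtreesExpect α γ (fun ts => growSum α γ (join ts) f) ((k + 2 - s.sum) :: s) =
        subtreesExpect α γ (fun ts => ENNReal.ofReal γ * f (join [join ts, single]) +
          (ENNReal.ofReal (s.length * α - γ) * f (join (ts ++ [single])) +
            growSumList α γ (fun ts => f (join ts)) ts)) ((k + 2 - s.sum) :: s) := by
      refine expect_congr _ fun ts hts => ?_
      have hlen := (growSumList_one (fun l hl => (hL l hl).2) hts).2
      have hne : ts ≠ [] := by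
        rintro rfl
        simp at hlen
      rw [growSum_join α γ hne, hlen]
      simp
    rw [hgrow, subtreesExpect, expect_add, expect_add, expect_const_mul, expect_const_mul,
      sizesGenerator]
    change _ * subtreesExpect α γ (fun ts => f (join [join ts, single])) _ +
      (_ * subtreesExpect α γ (fun ts => f (join (ts ++ [single]))) _ +
        subtreesExpect α γ (growSumList α γ fun ts => f (join ts)) _) = _
    rw [subtreesExpect_growSumList hL, ← subtreesExpect_concat_one α γ (fun ts => f (join ts)), ← hJ,
      incr, List.cons_append]
    -- When a sibling grows, the total number of leaves and the sum of the sibling sizes both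
    -- increase by one, so the size of the distinguished subtree is unchanged.
    have hincr : incr α (fun s' => J ((k + 1 + 2 - s'.sum) :: s')) s =
        incr α (fun s' => J ((k + 2 - s.sum) :: s')) s := by
      refine le_antisymm (incr_mono hs1 fun s' hs' _ _ => le_of_eq ?_)
        (incr_mono hs1 fun s' hs' _ _ => le_of_eq ?_) <;>
      · rw [hs', show k + 1 + 2 - (s.sum + 1) = k + 2 - s.sum by omega]
    have e1 : k + 1 + 2 - (s ++ [1]).sum = k + 2 - s.sum := by
      rw [List.sum_append, List.sum_singleton]; omega
    have e2 : k + 1 + 2 - s.sum = k + 2 - s.sum + 1 := by omega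
    have e3 : (((k + 2 - s.sum : ℕ) : ℝ) - α) = k + 2 - s.sum - α := by
      rw [Nat.cast_sub (by omega)]
      push_cast
      ring
    rw [hincr, e1, e2, e3]
    ring
  rw [show k + 1 + 2 - List.sum [1] = k + 2 by simp, ← h2, ← h1, ← mul_assoc]
  push_cast
  rw [ENNReal.inv_mul_cancel (by simpa using hpos) ENNReal.ofReal_ne_top, one_mul]

/-- The two properties are proved together: branching at `k + 1` needs the total weights up to `k +
2`, and the total weight at `k + 2` follows from branching at `k`. -/
theorem markovBranching_and_hasTotalWeight {α γ : ℝ} (hγ : 0 < γ) (hγα : γ ≤ α) (hα : α ≤ 1)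
    (k : ℕ) : MarkovBranching α γ k ∧ ∀ l, 1 ≤ l → l ≤ k + 2 → HasTotalWeight α γ l := by
  have key : ∀ k, MarkovBranching α γ k → (∀ l, 1 ≤ l → l ≤ k + 1 → HasTotalWeight α γ l) →
      MarkovBranching α γ k ∧ ∀ l, 1 ≤ l → l ≤ k + 2 → HasTotalWeight α γ l := by
    refine fun k h hW => ⟨h, fun l h1 h2 => ?_⟩
    rcases h2.lt_or_eq with h2 | rfl
    · exact hW l h1 (by omega)
    · exact h.hasTotalWeight hγ hγα hα hW
  induction k with
  | zero =>
    refine key 0 (fun f => ?_) fun l h1 h2 => ?_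
    · simp [agPlane, expect_pure, cherry_eq_join, sizesExpect, subtreesExpect_cons,
        subtreesExpect_nil]
    · obtain rfl : l = 1 := by omega
      exact hasTotalWeight_one α γ
  | succ k ih => exact key (k + 1) (ih.1.succ hα ih.2) ih.2

/-! ### The subtrees above the root of the infinite tree -/

section Split

variable {I K L E : Type*} [MeasurableSpace E]

theorem measurable_sumElim_comp (e : L → I ⊕ K) :
    Measurable fun p : (I → E) × (K → E) => fun l => Sum.elim p.1 p.2 (e l) := by
  refine measurable_pi_iff.2 fun l => ?_
  rcases e l with i | k
  · exact (measurable_pi_apply i).comp measurable_fst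
  · exact (measurable_pi_apply k).comp measurable_snd

/-- It suffices to compare finite-dimensional rectangles, and the preimage of one is a product of
two rectangles. -/
theorem map_infinitePi_prod_infinitePi (ν : Measure E) [IsProbabilityMeasure ν] (e : L ≃ I ⊕ K) :
    ((Measure.infinitePi fun _ : I => ν).prod (Measure.infinitePi fun _ : K => ν)).map
      (fun p l => Sum.elim p.1 p.2 (e l)) = Measure.infinitePi fun _ : L => ν := by
  refine Measure.eq_infinitePi _ fun s t ht => ?_
  rw [Measure.map_apply (measurable_sumElim_comp e)
    (MeasurableSet.pi s.countable_toSet fun i _ => ht i)]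
  have : (fun (p : (I → E) × (K → E)) l => Sum.elim p.1 p.2 (e l)) ⁻¹' (Set.pi s t) =
      (Set.pi ((s.map e.toEmbedding).toLeft : Finset I) fun i => t (e.symm (Sum.inl i))) ×ˢ
        (Set.pi ((s.map e.toEmbedding).toRight : Finset K) fun k => t (e.symm (Sum.inr k))) := by
    ext p
    simp only [Set.mem_preimage, Set.mem_pi, Set.mem_prod, Finset.mem_coe, Finset.mem_toLeft,
      Finset.mem_toRight, Finset.mem_map_equiv]
    constructor
    · exact fun h => ⟨fun i hi => by simpa using h _ hi, fun k hk => by simpa using h _ hk⟩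
    · rintro ⟨h1, h2⟩ l hl
      rcases hel : e l with i | k
      · have := h1 i (by rw [← hel, e.symm_apply_apply]; exact hl)
        rwa [← hel, e.symm_apply_apply] at this
      · have := h2 k (by rw [← hel, e.symm_apply_apply]; exact hl)
        rwa [← hel, e.symm_apply_apply] at this
  rw [this, Measure.prod_prod, Measure.infinitePi_pi _ fun i _ => ht _,
    Measure.infinitePi_pi _ fun k _ => ht _,
    ← Finset.prod_disjSum (f := fun x => ν (t (e.symm x))), Finset.toLeft_disjSum_toRight,
    Finset.prod_map]
  simp

theorem lintegral_infinitePi_sum (ν : Measure E) [IsProbabilityMeasure ν] (e : L ≃ I ⊕ K)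
    {f : (L → E) → ℝ≥0∞} (hf : Measurable f) :
    ∫⁻ ω, f ω ∂Measure.infinitePi (fun _ : L => ν) =
      ∫⁻ a, ∫⁻ b, f (fun l => Sum.elim a b (e l)) ∂Measure.infinitePi (fun _ : K => ν)
        ∂Measure.infinitePi (fun _ : I => ν) := by
  rw [← map_infinitePi_prod_infinitePi ν e, lintegral_map hf (measurable_sumElim_comp e)]
  exact lintegral_prod _ (hf.comp (measurable_sumElim_comp e)).aemeasurable

/-- The sequence with first term `a` and next terms `x 0, x 1, …`. -/
def consSeq (a : E) (x : ℕ → E) : ℕ → E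
  | 0 => a
  | n + 1 => x n

/-- The family with rows `x, y (0, ·), y (1, ·), …`. -/
def consRow (x : ℕ → E) (y : ℕ × ℕ → E) : ℕ × ℕ → E
  | (0, i) => x i
  | (n + 1, i) => y (n, i)

/-- A pair of indices is in the first row or in one of the next rows. -/
def rowEquiv : ℕ × ℕ ≃ ℕ ⊕ ℕ × ℕ where
  toFun
    | (0, i) => Sum.inl i
    | (n + 1, i) => Sum.inr (n, i)
  invFun := Sum.elim (fun i => (0, i)) fun p => (p.1 + 1, p.2)
  left_inv := by rintro ⟨_ | n, i⟩ <;> rfl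
  right_inv := by rintro (i | ⟨n, i⟩) <;> rfl

/-- A natural number is zero or a successor. -/
def natEquivUnitSum : ℕ ≃ Unit ⊕ ℕ where
  toFun
    | 0 => Sum.inl ()
    | n + 1 => Sum.inr n
  invFun := Sum.elim (fun _ => 0) fun n => n + 1
  left_inv := by rintro (_ | n) <;> rfl
  right_inv := by rintro (_ | n) <;> rfl

theorem lintegral_infinitePi_consSeq (ν : Measure E) [IsProbabilityMeasure ν]
    {f : (ℕ → E) → ℝ≥0∞} (hf : Measurable f) :
    ∫⁻ ω, f ω ∂Measure.infinitePi (fun _ : ℕ => ν) =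
      ∫⁻ a, ∫⁻ x, f (consSeq a x) ∂Measure.infinitePi (fun _ : ℕ => ν) ∂ν := by
  have h : ∀ (a : Unit → E) (x : ℕ → E),
      (fun l => Sum.elim a x (natEquivUnitSum l)) = consSeq (a ()) x := by
    intro a x
    funext l
    cases l <;> rfl
  have hm : Measurable fun p : E × (ℕ → E) => f (consSeq p.1 p.2) := by
    refine hf.comp (measurable_pi_iff.2 fun l => ?_)
    cases l with
    | zero => exact measurable_fst
    | succ n => exact (measurable_pi_apply n).comp measurable_snd
  rw [lintegral_infinitePi_sum ν natEquivUnitSum hf]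
  simp only [h]
  -- The first coordinate still lives in a product over `Unit`; evaluation at its point identifies
  -- its law with `ν`.
  have := lintegral_map (μ := Measure.infinitePi fun _ : Unit => ν)
    (hm.lintegral_prod_right' (ν := Measure.infinitePi fun _ : ℕ => ν)) (measurable_pi_apply ())
  rw [Measure.infinitePi_map_eval] at this
  exact this.symm

theorem lintegral_infinitePi_consRow (ν : Measure E) [IsProbabilityMeasure ν]
    {f : (ℕ × ℕ → E) → ℝ≥0∞} (hf : Measurable f) :
    ∫⁻ ω, f ω ∂Measure.infinitePi (fun _ : ℕ × ℕ => ν) =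
      ∫⁻ x, ∫⁻ y, f (consRow x y) ∂Measure.infinitePi (fun _ : ℕ × ℕ => ν)
        ∂Measure.infinitePi (fun _ : ℕ => ν) := by
  have h : ∀ (x : ℕ → E) (y : ℕ × ℕ → E),
      (fun l => Sum.elim x y (rowEquiv l)) = consRow x y := by
    intro x y
    funext l
    obtain ⟨_ | n, i⟩ := l <;> rfl
  rw [lintegral_infinitePi_sum ν rowEquiv hf]
  simp only [h]

theorem measurable_consRow :
    Measurable fun p : (ℕ → E) × (ℕ × ℕ → E) => consRow p.1 p.2 := by
  refine measurable_pi_iff.2 fun l => ?_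
  obtain ⟨_ | n, i⟩ := l
  · exact (measurable_pi_apply i).comp measurable_fst
  · exact (measurable_pi_apply (n, i)).comp measurable_snd

theorem measurable_consSeq (a : E) : Measurable (consSeq a) := by
  refine measurable_pi_iff.2 fun l => ?_
  cases l with
  | zero => exact measurable_const
  | succ n => exact measurable_pi_apply n

end Split

/-! ### Recursive equation for the infinite tree -/

theorem infiniteTree_cons (a : ℕ) (x : ℕ → ℕ) (τ : ℕ → ℕ × FinPlaneTree)
    (y : ℕ × ℕ → ℕ × FinPlaneTree) :
    infiniteTree (consSeq a x, consRow τ y) =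
      Tree.graft (((List.range (a + 1)).map fun i => (τ i).2).map FinPlaneTree.tree)
        (infiniteTree (x, y)) := by
  rw [infiniteTree, PlaneTree.spineTree_eq_join, infiniteTree, Tree.graft_shape, List.map_map]
  rfl

/-- A functional of trees that depends only on the ball of radius `R` around the root. -/
def IsLocal (R : ℕ) (f : Tree → ℝ≥0∞) : Prop :=
  ∀ t s, Tree.ball R t = Tree.ball R s → f t = f s

/-- A local functional is constant on `dloc`-balls of radius `exp (-R)`, hence continuous for any
topology on its values. -/
theorem IsLocal.measurable {R : ℕ} {f : Tree → ℝ≥0∞} (hf : IsLocal R f) : Measurable f := by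
  refine Continuous.measurable (continuous_def.2 fun s _ => ?_)
  refine Metric.isOpen_iff.2 fun t ht => ⟨Real.exp (-(R : ℝ)), Real.exp_pos _, fun u hu => ?_⟩
  have := hf u t ((Tree.dloc_lt_iff u t R).1 hu)
  rwa [Set.mem_preimage, this]

theorem IsLocal.graft {R : ℕ} {f : Tree → ℝ≥0∞} (hf : IsLocal (R + 1) f) (ts : List PlaneTree) :
    IsLocal R fun t => f (Tree.graft ts t) := fun _ _ h => hf _ _ (Tree.ball_graft R ts h)

theorem expect_pairLaw (α γ : ℝ) (f : FinPlaneTree → ℝ≥0∞) :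
    expect (pairLaw α γ) (fun p => f p.2) =
      expect (sibuya α) fun l => expect (agPlane α γ l) f := by
  rw [pairLaw, expect_bind, sibuya, expect_map]
  simp only [expect_map]

theorem lintegral_pairLaw_list (α γ : ℝ) (j : ℕ) (F : List FinPlaneTree → ℝ≥0∞) :
    ∫⁻ τ, F ((List.range j).map fun i => (τ i).2)
        ∂Measure.infinitePi (fun _ : ℕ => (pairLaw α γ).toMeasure) =
      expect (iidList (sibuya α) j) (subtreesExpect α γ F) := by
  have hm : ∀ (j : ℕ) (F : List FinPlaneTree → ℝ≥0∞),
      Measurable fun τ : ℕ → ℕ × FinPlaneTree => F ((List.range j).map fun i => (τ i).2) := by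
    intro j
    induction j with
    | zero =>
      intro F
      simp only [List.range_zero, List.map_nil]
      exact measurable_const
    | succ j ih =>
      intro F
      -- `F` is arbitrary, so joint measurability is obtained by adding one coordinate at a time
      -- with values in a countable set.
      have hG : Measurable fun p : (ℕ → ℕ × FinPlaneTree) × FinPlaneTree =>
          F ((List.range j).map (fun i => (p.1 i).2) ++ [p.2]) :=
        measurable_from_prod_countable_left fun t => ih fun ts => F (ts ++ [t])
      have h : Measurable fun τ : ℕ → ℕ × FinPlaneTree => (τ, (τ j).2) :=
        measurable_id.prodMk (measurable_snd.comp (measurable_pi_apply j))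
      simpa [List.range_succ, Function.comp_def] using hG.comp h
  induction j generalizing F with
  | zero => simp [expect_iidList_zero, subtreesExpect_nil]
  | succ j ih =>
    rw [lintegral_infinitePi_consSeq _ (hm (j + 1) F), lintegral_toMeasure, expect_iidList_succ]
    have h1 : ∀ (a : ℕ × FinPlaneTree) (τ : ℕ → ℕ × FinPlaneTree),
        (List.range (j + 1)).map (fun i => (consSeq a τ i).2) =
          a.2 :: (List.range j).map fun i => (τ i).2 := by
      intro a τ
      rw [List.range_succ_eq_map, List.map_cons, List.map_map]
      rfl
    simp only [h1]
    have h2 : ∀ a : ℕ × FinPlaneTree,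
        ∫⁻ τ, F (a.2 :: (List.range j).map fun i => (τ i).2)
          ∂Measure.infinitePi (fun _ : ℕ => (pairLaw α γ).toMeasure) =
        expect (iidList (sibuya α) j) (subtreesExpect α γ fun ts => F (a.2 :: ts)) :=
      fun a => ih fun ts => F (a.2 :: ts)
    simp only [h2]
    rw [expect_pairLaw α γ fun t =>
      expect (iidList (sibuya α) j) (subtreesExpect α γ fun ts => F (t :: ts))]
    refine expect_congr _ fun l _ => ?_
    rw [expect_comm]
    simp only [← subtreesExpect_cons]

/-- The first terms of the two families give the bushes at the root, and the remaining ones are an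
independent sample with the same law, whose tree sits above `v_1`. -/
theorem lintegral_infiniteTree (α γ : ℝ) {R : ℕ} {f : Tree → ℝ≥0∞} (hf : IsLocal (R + 1) f) :
    ∫⁻ ω, f (infiniteTree ω) ∂sampleMeasure α γ =
      expect (bushSizes α γ) (subtreesExpect α γ fun ts =>
        ∫⁻ ω, f (Tree.graft (ts.map FinPlaneTree.tree) (infiniteTree ω)) ∂sampleMeasure α γ) := by
  have hT : Measurable fun ω => f (infiniteTree ω) := hf.measurable.comp measurable_infiniteTree
  have hT' : ∀ ts : List PlaneTree, Measurable fun ω => f (Tree.graft ts (infiniteTree ω)) :=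
    fun ts => (hf.graft ts).measurable.comp measurable_infiniteTree
  set PX := Measure.infinitePi fun _ : ℕ => (betaGeometric (γ / α)).toMeasure with hPX
  set PY := Measure.infinitePi fun _ : ℕ => (pairLaw α γ).toMeasure with hPY
  set PZ := Measure.infinitePi fun _ : ℕ × ℕ => (pairLaw α γ).toMeasure with hPZ
  have hS : sampleMeasure α γ = PX.prod PZ := rfl
  have h1 : ∫⁻ ω, f (infiniteTree ω) ∂sampleMeasure α γ =
      ∫⁻ a, ∫⁻ x, ∫⁻ τ, ∫⁻ y, f (Tree.graft
        (((List.range (a + 1)).map fun i => (τ i).2).map FinPlaneTree.tree) (infiniteTree (x, y)))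
          ∂PZ ∂PY ∂PX ∂(betaGeometric (γ / α)).toMeasure := by
    rw [hS, lintegral_prod _ hT.aemeasurable,
      lintegral_infinitePi_consSeq _ hT.lintegral_prod_right']
    refine lintegral_congr fun a => lintegral_congr fun x => ?_
    refine (lintegral_infinitePi_consRow _ (hT.comp measurable_prodMk_left)).trans ?_
    refine lintegral_congr fun τ => lintegral_congr fun y => ?_
    rw [← infiniteTree_cons]
    rfl
  have h2 : ∀ a : ℕ, ∫⁻ x, ∫⁻ τ, ∫⁻ y, f (Tree.graft
        (((List.range (a + 1)).map fun i => (τ i).2).map FinPlaneTree.tree) (infiniteTree (x, y)))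
          ∂PZ ∂PY ∂PX = ∫⁻ τ, ∫⁻ ω, f (Tree.graft
        (((List.range (a + 1)).map fun i => (τ i).2).map FinPlaneTree.tree) (infiniteTree ω))
          ∂sampleMeasure α γ ∂PY := by
    intro a
    -- The variables are drawn in the order `x, τ, y`; exchanging `x` and `τ` reunites `x` and `y`
    -- into one sample.
    rw [lintegral_lintegral_swap]
    · refine lintegral_congr fun τ => ?_
      rw [hS, lintegral_prod _ (hT' _).aemeasurable]
    · have hm : Measurable fun p : ((ℕ → ℕ) × (ℕ → ℕ × FinPlaneTree)) ×
          (ℕ × ℕ → ℕ × FinPlaneTree) =>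
          f (infiniteTree (consSeq a p.1.1, consRow p.1.2 p.2)) :=
        hT.comp (((measurable_consSeq a).comp (measurable_fst.comp measurable_fst)).prodMk
          (measurable_consRow.comp ((measurable_snd.comp measurable_fst).prodMk measurable_snd)))
      have hm' := (hm.lintegral_prod_right' (ν := PZ)).aemeasurable (μ := PX.prod PY)
      simpa only [infiniteTree_cons, Function.uncurry_def] using hm'
  rw [h1, lintegral_toMeasure, expect_bushSizes]
  refine expect_congr _ fun a _ => ?_
  rw [h2, hPY, lintegral_pairLaw_list α γ (a + 1) fun ts =>
    ∫⁻ ω, f (Tree.graft (ts.map FinPlaneTree.tree) (infiniteTree ω)) ∂sampleMeasure α γ]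

/-! ### Convergence -/

theorem Tree.ball_zero (t s : Tree) : ball 0 t = ball 0 s := by
  induction t using Quotient.inductionOn with
  | h t =>
  induction s using Quotient.inductionOn with
  | h s =>
    refine congrArg (Quotient.mk PlaneTree.setoid) (PlaneTree.ext ?_)
    ext u
    simp only [PlaneTree.ball, Set.mem_ofPred_eq, Nat.le_zero, List.length_eq_zero_iff]
    constructor <;> rintro ⟨-, rfl⟩ <;> exact ⟨PlaneTree.root_mem _, rfl⟩

theorem Tree.graft_perm {ts ts' : List PlaneTree} (h : ts.Perm ts') (t : Tree) :
    graft ts t = graft ts' t := by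
  induction t using Quotient.inductionOn with
  | h t => exact PlaneTree.shape_join_perm (h.cons t)

/-- Once the siblings are fixed, `f` is a functional of the distinguished subtree that is local at a
radius smaller by one, so the induction hypothesis applies to it. Two bounds of Fatou type, over the
siblings and over their sizes, give the result. -/
theorem lintegral_infiniteTree_le_liminf {α γ : ℝ} (hγ : 0 < γ) (hγα : γ ≤ α) (hα : α ≤ 1) (R : ℕ)
    {f : Tree → ℝ≥0∞} (hf : IsLocal R f) (hf1 : ∀ t, f t ≤ 1) :
    ∫⁻ ω, f (infiniteTree ω) ∂sampleMeasure α γ ≤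
      liminf (fun n => expect (agPlane α γ n) fun t => f t.tree.shape) atTop := by
  induction R generalizing f with
  | zero =>
    obtain ⟨c, hc⟩ : ∃ c, ∀ t, f t = c :=
      ⟨f PlaneTree.single.shape, fun t => hf _ _ (Tree.ball_zero _ _)⟩
    simp [hc, expect_const]
  | succ R ih =>
    set u : List FinPlaneTree → ℕ → ℝ≥0∞ := fun ts n =>
      expect (agPlane α γ n) fun t => f (Tree.graft (ts.map FinPlaneTree.tree) t.tree.shape) with hu
    -- Infima over `n ≥ N` increase with `N` to the lower limit, so monotone convergence applies.
    set h : ℕ → List FinPlaneTree → ℝ≥0∞ := fun N ts => ⨅ n ≥ N, u ts n with hh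
    -- The cutoff `s.sum ≤ N` keeps the distinguished subtree large: it has `k + 2 - s.sum ≥ N`
    -- leaves as soon as `k ≥ 2 * N`.
    set H : ℕ → List ℕ → ℝ≥0∞ := fun N s => if s.sum ≤ N then subtreesExpect α γ (h N) s else 0
      with hH
    have hu1 : ∀ ts n, u ts n ≤ 1 := fun ts n => expect_le _ fun t => hf1 _
    have hh1 : ∀ N ts, h N ts ≤ 1 := fun N ts => (iInf₂_le N le_rfl).trans (hu1 ts N)
    have hH1 : ∀ N s, H N s ≠ ∞ := fun N s => by
      refine ne_top_of_le_ne_top ENNReal.one_ne_top ?_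
      simp only [hH]
      split_ifs
      · exact expect_le _ (hh1 N)
      · exact zero_le_one
    have hhmono : Monotone h := fun N N' hN ts =>
      le_iInf₂ fun n hn => iInf₂_le n (hN.trans hn)
    have hHmono : Monotone H := fun N N' hN s => by
      simp only [hH]
      split_ifs
      · exact expect_mono _ fun ts _ => hhmono hN ts
      · omega
      · exact zero_le
      · exact le_rfl
    have hhperm : ∀ N, PermInvariant (h N) := fun N ts ts' hts => by
      simp only [hh, hu, Tree.graft_perm (hts.map FinPlaneTree.tree)]
    have hHperm : ∀ N, PermInvariant (H N) := fun N s s' hs => by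
      have : subtreesExpect α γ (h N) s = subtreesExpect α γ (h N) s' :=
        permInvariant_expect_indepList (hhperm N) _ _ (hs.map (agPlane α γ))
      simp only [hH, hs.sum_eq, this]
    have hlim : ∀ ts, ∫⁻ ω, f (Tree.graft (ts.map FinPlaneTree.tree) (infiniteTree ω))
        ∂sampleMeasure α γ ≤ ⨆ N, h N ts := fun ts => by
      refine (ih (hf.graft _) fun t => hf1 _).trans ?_
      rw [liminf_eq_iSup_iInf_of_nat]
    have hle : ∀ s, subtreesExpect α γ (fun ts => ∫⁻ ω,
        f (Tree.graft (ts.map FinPlaneTree.tree) (infiniteTree ω)) ∂sampleMeasure α γ) s ≤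
        ⨆ N, H N s := fun s => by
      refine (expect_mono _ fun ts _ => hlim ts).trans ?_
      rw [expect_iSup _ hhmono]
      refine iSup_le fun N => le_iSup_of_le (max N s.sum) ?_
      simp only [hH, le_max_right, if_true]
      exact expect_mono _ fun ts _ => hhmono (le_max_left _ _) ts
    rw [lintegral_infiniteTree α γ hf]
    refine (expect_mono _ fun s _ => hle s).trans ?_
    rw [expect_iSup _ hHmono]
    refine iSup_le fun N => (expect_bushSizes_le_liminf hγ hγα hα (hHperm N) (hH1 N)).trans ?_
    -- The branching identity is indexed by `k + 2` leaves, whence the shift by two.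
    rw [← liminf_nat_add (fun n => expect (agPlane α γ n) fun t => f t.tree.shape) 2]
    refine liminf_le_liminf ?_
    filter_upwards [eventually_ge_atTop (2 * N)] with k hk
    rw [(markovBranching_and_hasTotalWeight hγ hγα hα k).1]
    refine sizesExpect_mono fun s _ _ _ => ?_
    simp only [hH]
    split_ifs with hs
    · rw [subtreesExpect_cons]
      simp only [subtreesExpect]
      -- With the siblings drawn first, the inner expectation over the distinguished subtree is a
      -- term of the infimum `h N ts`.
      rw [expect_comm]
      exact expect_mono _ fun ts _ => iInf₂_le _ (by omega)
    · exact zero_le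

theorem lintegral_AG (α γ : ℝ) (n : ℕ) {f : Tree → ℝ≥0∞} (hf : Measurable f) :
    ∫⁻ t, f t ∂(AG α γ n : Measure Tree) = expect (agPlane α γ n) fun t => f t.tree.shape := by
  rw [← lintegral_toMeasure]
  exact lintegral_map hf Measurable.of_discrete

theorem tendsto_AG {α γ : ℝ} (hγ : 0 < γ) (hγα : γ ≤ α) (hα : α ≤ 1) :
    Tendsto (fun n : ℕ => AG α γ n) atTop (𝓝 (AGInfty α γ)) := by
  refine tendsto_of_forall_isOpen_le_liminf' fun U hU => ?_
  -- `V R` is the set of trees whose membership in `U` is decided by the ball of radius `R`. These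
  -- sets exhaust the open set `U`, and their indicators are local.
  set V : ℕ → Set Tree := fun R => {t | ∀ s, Tree.ball R s = Tree.ball R t → s ∈ U} with hV
  have hVU : ∀ R, V R ⊆ U := fun R t ht => ht t rfl
  have hVmono : Monotone V := fun R R' hR t ht s hs => ht s (Tree.ball_eq_of_le hR hs)
  have hUV : U = ⋃ R, V R := by
    refine Set.Subset.antisymm (fun t ht => ?_) (Set.iUnion_subset hVU)
    obtain ⟨ε, hε, hball⟩ := Metric.isOpen_iff.1 hU t ht
    obtain ⟨R, hR⟩ : ∃ R : ℕ, Real.exp (-(R : ℝ)) < ε :=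
      ((Real.tendsto_exp_neg_atTop_nhds_zero.comp tendsto_natCast_atTop_atTop).eventually
        (gt_mem_nhds hε)).exists
    exact Set.mem_iUnion.2 ⟨R, fun s hs => hball (((Tree.dloc_lt_iff s t R).2 hs).trans hR)⟩
  have hloc : ∀ R, IsLocal R ((V R).indicator 1) := fun R t s hts => by
    have : t ∈ V R ↔ s ∈ V R := by simp only [hV, Set.mem_ofPred_eq, hts]
    by_cases hs : s ∈ V R
    · rw [Set.indicator_of_mem hs, Set.indicator_of_mem (this.2 hs), Pi.one_apply, Pi.one_apply]
    · rw [Set.indicator_of_notMem hs, Set.indicator_of_notMem (mt this.1 hs)]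
  have hmeas : ∀ R, MeasurableSet (V R) := fun R =>
    (measurable_indicator_const_iff (1 : ℝ≥0∞)).1 (hloc R).measurable
  conv_lhs => rw [hUV]
  rw [hVmono.measure_iUnion]
  refine iSup_le fun R => ?_
  have h1 : (AGInfty α γ : Measure Tree) (V R) =
      ∫⁻ ω, (V R).indicator 1 (infiniteTree ω) ∂sampleMeasure α γ := by
    rw [← lintegral_indicator_one (hmeas R)]
    exact lintegral_map (hloc R).measurable measurable_infiniteTree
  rw [h1]
  refine (lintegral_infiniteTree_le_liminf hγ hγα hα R (hloc R) fun t =>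
    Set.indicator_le_self' (fun _ _ => zero_le) t).trans
    (liminf_le_liminf (Eventually.of_forall fun n => ?_))
  rw [← lintegral_AG α γ n (hloc R).measurable, lintegral_indicator_one (hmeas R)]
  exact measure_mono (hVU R)

end AlphaGamma

theorem mainTheorem11 (α γ : ℝ) (hγ : 0 < γ) (hγα : γ ≤ α) (hα : α ≤ 1) :
    Tendsto (fun n : ℕ => AlphaGamma.AG α γ n) atTop (𝓝 (AlphaGamma.AGInfty α γ)) :=
  AlphaGamma.tendsto_AG hγ hγα hα
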